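/- Let $n\ge 2$ and $k\ge 1$ be integers. Then $\mathrm{Csp}(\mathfrak P^{n,k})$ can be solved by a symmetric linear $\mathbb Z_2$-Datalog program with at most $2k^2+k-2$ stages. Here the notions are as follows. **The structures.** Put $O_n=\{1,\dots,n-1\}$. The domain of $\mathfrak P^{n,k}$ is the set of sequences $$P^{n,k}=\{0^i c : 0\le i<k,\ c\in O_n\}\cup\{0^k\},$$ so $P^{n,0}=\{\epsilon\}$ and $P^{n,k+1}$ is the disjoint union of $O_n$ and $\psi_0(P^{n,k})$, where $\psi_0\colon P^{n,k}\to P^{n,k+1}$, $v\mapsto 0v$. Let $\psi_k\colon P^{n,k}\to P^{n,k+1}$ fix every $0^ic$ ($c\neq0$) and map $0^k$ to $0^{k+1}$. Put $T^{n,k+1}_{0,k}=\{(\psi_0(v),\psi_k(v)) : v\in P^{n,k}\}$. The signature of $\mathfrak O_n$, with domain $O_n$, consists of a unary $R_Y$ for every $Y\subseteq O_n$ denoting $Y$, a binary $R_\sigma$ for every permutation $\sigma$ of $O_n$ denoting the graph of $\sigma$, and a ternary $\mathrm{Eq}_3$ denoting equality of all three entries. The structure $\mathfrak P^{n,0}$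 has the unary relations $\emptyset$ and $\{\epsilon\}$ and the binary and ternary equality relations. The relations of $\mathfrak P^{n,k+1}$ are: for every symbol $\rho_1$ of $\mathfrak P^{n,k}$ and every symbol $\rho_2$ of $\mathfrak O_n$ of the same arity, a symbol $(\rho_1,\rho_2)$ denoting $\psi_0(\rho_1^{\mathfrak P^{n,k}})\cup\rho_2^{\mathfrak O_n}$; the full binary relation; the relation $T^{n,k+1}_{0,k}$; and, only if $k+1=1$, the graph of the permutation of $P^{n,1}$ that switches $(0)$ and $(1)$ and fixes all other elements, and the ternary relation $\{(x_1,x_2,x_3)\in\{(0),(1)\}^3 : x_1+x_2+x_3=1 \bmod 2\}$. **The programs.** A $\mathbb Z_2$-Datalog program of stage one with input signature $\tau$ is a Datalog program (equality is allowed in bodies) whose IDBs are a finite set $\sigma$ of ordinary IDBs together with, for some fixed $q\in\mathbb N$, special IDBs $L^q_{a_1,a_2,a_3,b}$ of arity $q+3$ ($a_1,a_2,a_3,b\in\mathbb Z_2$). On a finite $\tau$-structure with domain $A$ one computes the fixed point of the Datalog program. For $u\in A^q$ consider the system of all equations $a_1x_{v_1}+a_2x_{v_2}+a_3x_{v_3}=b$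 over $\mathbb Z_2$ such that $L^q_{a_1,a_2,a_3,b}(u,v_1,v_2,v_3)$ has been derived; $u$ is put into $L^\top$ if the system is satisfiable, and into $L^\bot$ otherwise. The output consists of the relations in $\sigma\cup\{L^\top,L^\bot\}$. A program with $m$ stages is a sequence of $m$ such programs, each of which takes as input the output of its predecessor. The last one has a goal predicate of arity $0$ in $\sigma$, which is derived by the Datalog rules or, optionally, by a final rule from $L^\bot$. The program is symmetric linear if in every stage every rule contains at most one IDB in its body, and for every rule $P(\bar x)\,{:}{-}\,\phi\wedge Q(\bar y)$ with an IDB $Q$ in the body the rule $Q(\bar y)\,{:}{-}\,\phi\wedge P(\bar x)$ is also present (up to renaming of variables). The program solves $\mathrm{Csp}(\mathfrak B)$ if on every finite structure $\mathfrak A$ in the signature of $\mathfrak B$ it derives the goal predicate if and only if there is no homomorphism from $\mathfrak A$ to $\mathfrak B$. -/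

import Mathlib

open FirstOrder

/-! ### Relational signatures, structures, constraint satisfaction problems -/

/-- The relational first-order language whose relation symbols of arity `l` are `R l`. -/
abbrev relLang (R : ℕ → Type) : Language := ⟨fun _ => Empty, R⟩

/-- The structure with domain `A` and the given relations. -/
@[reducible] def mkStr {R : ℕ → Type} {A : Type} (rel : ∀ l, R l → (Fin l → A) → Prop) :
    (relLang R).Structure A where
  funMap := fun f => f.elim
  RelMap := fun {l} r t => rel l r t

/-- `Csp(𝔅)`: the structure `𝔄` has a homomorphism to `𝔅`. -/
def InCsp {R : ℕ → Type} {A B : Type} (𝔅 : (relLang R).Structure B)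
    (𝔄 : (relLang R).Structure A) : Prop :=
  Nonempty (A →[relLang R] B)

/-! ### Datalog -/

/-- Atomic formulas `P(x₁, …, x_l)` with symbols from `R` and variables `Fin v`. -/
structure Atom (R : ℕ → Type) (v : ℕ) where
  arity : ℕ
  sym : R arity
  args : Fin arity → Fin v

/-- The EDB conjuncts of a body: atoms in the input signature, and equalities. -/
inductive EdbAtom (E : ℕ → Type) (v : ℕ) : Type
  | rel (a : Atom E v) : EdbAtom E v
  | eq (x y : Fin v) : EdbAtom E v

def Atom.rename {R : ℕ → Type} {v w : ℕ} (e : Fin v → Fin w) (a : Atom R v) : Atom R w :=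
  ⟨a.arity, a.sym, e ∘ a.args⟩

def EdbAtom.rename {E : ℕ → Type} {v w : ℕ} (e : Fin v → Fin w) : EdbAtom E v → EdbAtom E w
  | .rel a => .rel (a.rename e)
  | .eq x y => .eq (e x) (e y)

/-- Truth of an EDB conjunct in `𝔄` under the assignment `h`. -/
def EdbAtom.Holds {E : ℕ → Type} {v : ℕ} {A : Type} (𝔄 : (relLang E).Structure A)
    (h : Fin v → A) : EdbAtom E v → Prop
  | .rel a => 𝔄.RelMap a.sym (h ∘ a.args)
  | .eq x y => h x = h y

/-- A Datalog rule `head :- edb ∧ idb` with EDBs `E`, IDBs `I` and variables `Fin vars`.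
Variables may repeat, and head variables need not occur in the body. -/
structure Rule (E I : ℕ → Type) where
  vars : ℕ
  head : Atom I vars
  edb : List (EdbAtom E vars)
  idb : List (Atom I vars)

/-- `Derives rules 𝔄 l P t`: the program derives `P(t)` on `𝔄`, that is, `t` belongs to `P` in the
structure obtained from `𝔄`, with all IDBs initially empty, by applying rules until nothing new
can be derived. -/
inductive Derives {E I : ℕ → Type} (rules : Set (Rule E I)) {A : Type}
    (𝔄 : (relLang E).Structure A) : (l : ℕ) → I l → (Fin l → A) → Prop
  | step (r : Rule E I) (hr : r ∈ rules) (h : Fin r.vars → A)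
      (hedb : ∀ a ∈ r.edb, a.Holds 𝔄 h)
      (hidb : ∀ a ∈ r.idb, Derives rules 𝔄 a.arity a.sym (h ∘ a.args)) :
      Derives rules 𝔄 r.head.arity r.head.sym (h ∘ r.head.args)

/-- Every body contains at most one conjunct with an IDB. -/
def LinearRules {E I : ℕ → Type} (rules : Set (Rule E I)) : Prop :=
  ∀ r ∈ rules, r.idb.length ≤ 1

/-- For every rule `P(x) :- φ ∧ Q(y)` with a single IDB conjunct `Q(y)` there is the rule
`Q(y) :- φ ∧ P(x)`, up to renaming variables and reordering `φ`. -/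
def SymmetricRules {E I : ℕ → Type} (rules : Set (Rule E I)) : Prop :=
  ∀ r ∈ rules, ∀ q : Atom I r.vars, r.idb = [q] →
    ∃ s ∈ rules, ∃ e : Fin r.vars ≃ Fin s.vars,
      s.head = q.rename e ∧ s.idb = [r.head.rename e] ∧
        s.edb.Perm (r.edb.map (EdbAtom.rename e))

/-! ### Datalog with linear equations over the two-element field -/

/-- The special IDBs `L^k_{a₁,a₂,a₃,b}` of arity `k + 3`. -/
inductive EqnSym (k : ℕ) : ℕ → Type
  | eqn (a : Fin 3 → ZMod 2) (b : ZMod 2) : EqnSym k (k + 3)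

/-- The `k`-ary symbols `L^⊤` (satisfiable) and `L^⊥` (unsatisfiable). -/
inductive SatSym (k : ℕ) : ℕ → Type
  | top : SatSym k k
  | bot : SatSym k k

/-- All IDBs of arity `l` of a stage: the ordinary ones and the special ones. -/
abbrev StageIdb (Idb : ℕ → Type) (k : ℕ) (l : ℕ) : Type := Idb l ⊕ EqnSym k l

/-- A program of stage one with EDBs `E`: a Datalog program whose IDBs are the ordinary ones `Idb`
and the special ones `EqnSym param`. -/
structure Stage (E : ℕ → Type) where
  Idb : ℕ → Type
  finite_idb : Finite (Σ l, Idb l)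
  param : ℕ
  rules : Set (Rule E (StageIdb Idb param))
  finite_rules : rules.Finite

namespace Stage

variable {E : ℕ → Type} (S : Stage E) {A : Type} (𝔄 : (relLang E).Structure A)

/-- The output signature: the ordinary IDBs together with `L^⊤` and `L^⊥`. -/
def Out : ℕ → Type := fun l => S.Idb l ⊕ SatSym S.param l

/-- The system of linear equations attached to the parameter tuple `u` is satisfiable: it consists
of `a₁ x_{v₁} + a₂ x_{v₂} + a₃ x_{v₃} = b` whenever `L^k_{a₁,a₂,a₃,b}(u, v₁, v₂, v₃)` is derived. -/
def SystemSat (u : Fin S.param → A) : Prop :=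
  ∃ x : A → ZMod 2, ∀ (a : Fin 3 → ZMod 2) (b : ZMod 2) (v : Fin 3 → A),
    Derives S.rules 𝔄 (S.param + 3) (Sum.inr (EqnSym.eqn a b)) (Fin.append u v) →
      a 0 * x (v 0) + a 1 * x (v 1) + a 2 * x (v 2) = b

/-- The relations of the output structure. -/
def outRel (l : ℕ) : S.Out l → (Fin l → A) → Prop
  | Sum.inl P, t => Derives S.rules 𝔄 l (Sum.inl P) t
  | Sum.inr .top, t => S.SystemSat 𝔄 t
  | Sum.inr .bot, t => ¬ S.SystemSat 𝔄 t

/-- The output structure of the stage on input `𝔄`. -/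
@[reducible] def output : (relLang S.Out).Structure A := mkStr (S.outRel 𝔄)

end Stage

/-- Programs with EDBs `E` and `m` stages; every stage runs on the output of the previous one. The
last stage has a goal predicate of arity `0`, which may in addition be derived by a final
application of `goal :- L^⊥(y₁, …, y_k)`, if `finalRule` is set. -/
inductive ZTwoDatalog : (ℕ → Type) → ℕ → Type 1
  | last {E : ℕ → Type} (S : Stage E) (goal : S.Idb 0) (finalRule : Bool) : ZTwoDatalog E 1
  | cons {E : ℕ → Type} {m : ℕ} (S : Stage E) (P : ZTwoDatalog S.Out m) : ZTwoDatalog E (m + 1)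

namespace ZTwoDatalog

/-- All stages consist of linear rules and are symmetric. -/
def SymmetricLinear : {E : ℕ → Type} → {m : ℕ} → ZTwoDatalog E m → Prop
  | _, _, last S _ _ => LinearRules S.rules ∧ SymmetricRules S.rules
  | _, _, cons S P => (LinearRules S.rules ∧ SymmetricRules S.rules) ∧ P.SymmetricLinear

/-- The program derives the goal predicate on the structure `𝔄`. -/
def DerivesGoal {A : Type} : {E : ℕ → Type} → {m : ℕ} → ZTwoDatalog E m →
    (relLang E).Structure A → Prop
  | _, _, last S goal finalRule, 𝔄 =>
      Derives S.rules 𝔄 0 (Sum.inl goal) Fin.elim0 ∨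
        (finalRule = true ∧ ∃ u : Fin S.param → A, ¬ S.SystemSat 𝔄 u)
  | _, _, cons S P, 𝔄 => P.DerivesGoal (S.output 𝔄)

/-- The program solves `Csp(𝔅)`: on every finite structure it derives the goal predicate if and
only if the structure has no homomorphism to `𝔅`. -/
def Solves {E : ℕ → Type} {m : ℕ} {B : Type} (P : ZTwoDatalog E m)
    (𝔅 : (relLang E).Structure B) : Prop :=
  ∀ (A : Type) [Finite A] (𝔄 : (relLang E).Structure A), P.DerivesGoal 𝔄 ↔ ¬ InCsp 𝔅 𝔄

end ZTwoDatalog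

/-! ### The structures `𝔓^{n,k}` -/

/-- The set `O_n = {1, …, n - 1}`. -/
abbrev Outer (n : ℕ) : Type := {c : Fin n // (c : ℕ) ≠ 0}

/-- The domain `P^{n,k}`: the sequences `0^i c` with `i < k` and `c ∈ O_n`, and the sequence `0^k`.
So `P^{n,0} = {ε}`, and `P^{n,k+1}` is the disjoint union of `O_n` and `{0 v | v ∈ P^{n,k}}`. The
constructor `zero` is the embedding `ψ^{n,k+1}_0`. -/
inductive Leaf (n : ℕ) : ℕ → Type
  | nil : Leaf n 0
  | out {k : ℕ} (c : Outer n) : Leaf n (k + 1)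
  | zero {k : ℕ} (v : Leaf n k) : Leaf n (k + 1)

namespace Leaf

variable {n : ℕ}

/-- The element as a sequence of numbers. -/
def toSeq : {k : ℕ} → Leaf n k → List ℕ
  | _, nil => []
  | _, out c => [(c.1 : ℕ)]
  | _, zero v => 0 :: v.toSeq

/-- The embedding `ψ^{n,k+1}_k : P^{n,k} → P^{n,k+1}`, which fixes every `0^i c` with `c ≠ 0` and
maps `0^k` to `0^{k+1}`. -/
def omitLast : {k : ℕ} → Leaf n k → Leaf n (k + 1)
  | _, nil => zero nil
  | _, out c => out c
  | _, zero v => zero v.omitLast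

end Leaf

/-- The signature of the structure `𝔒_n`: the symbols `R_Y`, `R_σ`, `Eq₃`. -/
inductive OuterSym (n : ℕ) : ℕ → Type
  | subset (Y : Set (Outer n)) : OuterSym n 1
  | perm (σ : Equiv.Perm (Outer n)) : OuterSym n 2
  | eqThree : OuterSym n 3

/-- The relations of `𝔒_n`. -/
def OuterSym.Rel {n : ℕ} : {l : ℕ} → OuterSym n l → (Fin l → Outer n) → Prop
  | _, subset Y, t => t 0 ∈ Y
  | _, perm σ, t => σ (t 0) = t 1
  | _, eqThree, t => t 0 = t 1 ∧ t 1 = t 2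

/-- The signature `τ_{n,k}`; `TauSym n k l` is the set of its symbols of arity `l`. -/
inductive TauSym (n : ℕ) : ℕ → ℕ → Type
  | empty : TauSym n 0 1
  | point : TauSym n 0 1
  | eqTwo : TauSym n 0 2
  | eqThree : TauSym n 0 3
  | pair {k l : ℕ} (ρ : TauSym n k l) (θ : OuterSym n l) : TauSym n (k + 1) l
  | full {k : ℕ} : TauSym n (k + 1) 2
  | transfer {k : ℕ} : TauSym n (k + 1) 2
  | swap : TauSym n 1 2
  | lin : TauSym n 1 3

/-- The relations of `𝔓^{n,k}`. The symbol `pair ρ θ` denotes the union of `ψ^{n,k+1}_0(ρ)` and `θ`,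
and `transfer` denotes `T^{n,k+1}_{0,k} = {(ψ^{n,k+1}_0(v), ψ^{n,k+1}_k(v)) | v ∈ P^{n,k}}`. -/
def TauSym.Rel {n : ℕ} : {k l : ℕ} → TauSym n k l → (Fin l → Leaf n k) → Prop
  | _, _, empty, _ => False
  | _, _, point, t => t 0 = Leaf.nil
  | _, _, eqTwo, t => t 0 = t 1
  | _, _, eqThree, t => t 0 = t 1 ∧ t 1 = t 2
  | _, _, pair ρ θ, t =>
      (∃ s, ρ.Rel s ∧ t = fun i => Leaf.zero (s i)) ∨ (∃ s, θ.Rel s ∧ t = fun i => Leaf.out (s i))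
  | _, _, full, _ => True
  | _, _, transfer, t => ∃ v, t 0 = Leaf.zero v ∧ t 1 = v.omitLast
  | _, _, swap, t =>
      ((t 0).toSeq = [0] ∧ (t 1).toSeq = [1]) ∨ ((t 0).toSeq = [1] ∧ (t 1).toSeq = [0]) ∨
        ((t 0).toSeq ≠ [0] ∧ (t 0).toSeq ≠ [1] ∧ t 1 = t 0)
  | _, _, lin, t =>
      ((t 0).toSeq, (t 1).toSeq, (t 2).toSeq) ∈
        ({([1], [1], [1]), ([1], [0], [0]), ([0], [1], [0]), ([0], [0], [1])} :
          Set (List ℕ × List ℕ × List ℕ))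

/-- The structure `𝔓^{n,k}`. -/
@[reducible] def structP (n k : ℕ) : (relLang (TauSym n k)).Structure (Leaf n k) :=
  mkStr fun _ R t => R.Rel t

/-! In fact `k` stages suffice, and `k ≤ 2k² + k - 2`. For `r = k-1, …, 0`, one stage tests for
every element `u` whether the assumption `u ∈ block r` (`u` starts with `r` zeros) is tenable. If
its system is unsatisfiable, `L^⊥(u)` passes the negation on to the later stages. At `r = 0` the
assumption is void, so unsatisfiability means that there is no homomorphism.

A stage contains every rule with one IDB atom and at most one EDB atom whose head and body are
equivalent over the template. Such a set of rules is symmetric by construction, and it is sound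
because homomorphisms preserve what is derived. Its strength is that it can follow an undirected
chain of equivalent statements `a ∈ W` in one variable while it remembers the parameter and a
conclusion about two other elements (`Derived.walk`).

For completeness, the constraints generate an equivalence `BlockEq` on the statements `a ∈ block f`.
The rank of a class is its least `f`. By downward induction on the rank, every class is either
refuted or has a partial solution. In rank `k` there is only the leaf `0^k`. For rank `r < k`
(`exists_isSolution`), take for each element of the class the longest block that the class imposes
on it, and choose its next letter. Constraints link these letters by permutations, and on the last
position also by linear equations. Satisfiability of the system yields a coherent choice
(`exists_letters`). A nonzero letter completes the leaf. The letter `0` leads into a class of larger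
rank, which is not refuted and hence already solved. Finally, the solutions for the classes of rank
`0` are glued to a homomorphism. -/

/-! ### Leaves, their letters, and the sets `block` and `part` -/

namespace Leaf

variable {n : ℕ}

/-- The letter of a leaf at a position, where `none` stands for the letter `0`; positions behind
the end of the sequence carry `none`. -/
def entry : {k : ℕ} → Leaf n k → ℕ → Option (Outer n)
  | _, nil, _ => none
  | _, out c, 0 => some c
  | _, out _, _ + 1 => none
  | _, zero _, 0 => none
  | _, zero v, i + 1 => v.entry i

@[simp] theorem entry_nil (i : ℕ) : (nil : Leaf n 0).entry i = none := by simp [entry]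
@[simp] theorem entry_out_zero {k : ℕ} (c : Outer n) :
    (out c : Leaf n (k + 1)).entry 0 = some c := by simp [entry]
@[simp] theorem entry_out_succ {k : ℕ} (c : Outer n) (i : ℕ) :
    (out c : Leaf n (k + 1)).entry (i + 1) = none := by simp [entry]
@[simp] theorem entry_zero_zero {k : ℕ} (v : Leaf n k) : (zero v).entry 0 = none := by
  simp [entry]
@[simp] theorem entry_zero_succ {k : ℕ} (v : Leaf n k) (i : ℕ) :
    (zero v).entry (i + 1) = v.entry i := by simp [entry]

@[simp] theorem entry_omitLast {k : ℕ} (v : Leaf n k) (i : ℕ) :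
    v.omitLast.entry i = v.entry i := by
  induction v generalizing i with
  | nil => cases i <;> simp [omitLast]
  | out c => cases i <;> simp [omitLast]
  | zero v ih => cases i <;> simp [omitLast, ih]

theorem entry_eq_none_of_le {k : ℕ} (v : Leaf n k) {i : ℕ} (h : k ≤ i) : v.entry i = none := by
  induction v generalizing i with
  | nil => simp
  | out c => obtain ⟨i, rfl⟩ : ∃ j, i = j + 1 := ⟨i - 1, by omega⟩; simp
  | zero v ih =>
    obtain ⟨i, rfl⟩ : ∃ j, i = j + 1 := ⟨i - 1, by omega⟩
    simpa using ih (by omega)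

theorem entry_eq_none_of_some {k : ℕ} (v : Leaf n k) {f i : ℕ} {c : Outer n}
    (h : v.entry f = some c) (hi : f < i) : v.entry i = none := by
  induction v generalizing f i with
  | nil => simp
  | out c => obtain ⟨i, rfl⟩ : ∃ j, i = j + 1 := ⟨i - 1, by omega⟩; simp
  | zero v ih =>
    obtain ⟨i, rfl⟩ : ∃ j, i = j + 1 := ⟨i - 1, by omega⟩
    cases f with
    | zero => simp at h
    | succ f => simpa using ih (by simpa using h) (by omega)

theorem ext_entry {k : ℕ} {v w : Leaf n k} (h : ∀ i, v.entry i = w.entry i) : v = w := by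
  induction v with
  | nil => cases w; rfl
  | out c =>
    cases w with
    | out d => simpa using h 0
    | zero w => simpa using h 0
  | zero v ih =>
    cases w with
    | out d => simpa using h 0
    | zero w => rw [ih fun i => by simpa using h (i + 1)]

instance {k : ℕ} : Finite (Leaf n k) := by
  refine Finite.of_injective (β := Fin k → Option (Outer n)) (fun v i => v.entry i) ?_
  intro v w h
  refine ext_entry fun i => ?_
  by_cases hi : i < k
  · exact congrFun h ⟨i, hi⟩
  · rw [entry_eq_none_of_le v (by omega), entry_eq_none_of_le w (by omega)]

/-- The leaves that start with `f` zeros. -/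
def block {k : ℕ} (f : ℕ) : Set (Leaf n k) := {v | ∀ i < f, v.entry i = none}

/-- The leaves that start with `f` zeros followed by the letter `μ`. -/
def part {k : ℕ} (f : ℕ) (μ : Option (Outer n)) : Set (Leaf n k) :=
  {v | v ∈ block f ∧ v.entry f = μ}

@[simp] theorem mem_block_zero {k : ℕ} (v : Leaf n k) : v ∈ block 0 := by simp [block]

@[simp] theorem zero_mem_block_succ {k f : ℕ} (v : Leaf n k) :
    zero v ∈ block (f + 1) ↔ v ∈ block f := by
  constructor
  · intro h i hi
    simpa using h (i + 1) (by omega)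
  · intro h i hi
    cases i with
    | zero => simp
    | succ i => simpa using h i (by omega)

@[simp] theorem out_notMem_block_succ {k f : ℕ} (c : Outer n) :
    (out c : Leaf n (k + 1)) ∉ block (f + 1) := by
  intro h
  simpa using h 0 (by omega)

@[simp] theorem mem_part_zero {k : ℕ} (v : Leaf n k) (μ : Option (Outer n)) :
    v ∈ part 0 μ ↔ v.entry 0 = μ := by simp [part]

@[simp] theorem zero_mem_part_succ {k f : ℕ} (v : Leaf n k) (μ : Option (Outer n)) :
    zero v ∈ part (f + 1) μ ↔ v ∈ part f μ := by simp [part]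

@[simp] theorem out_notMem_part_succ {k f : ℕ} (c : Outer n) (μ : Option (Outer n)) :
    (out c : Leaf n (k + 1)) ∉ part (f + 1) μ := by simp [part]

theorem part_none {k : ℕ} (f : ℕ) : (part f none : Set (Leaf n k)) = block (f + 1) := by
  ext v
  simp only [part, block, Set.mem_ofPred_eq]
  constructor
  · rintro ⟨h, h'⟩ i hi
    rcases Nat.lt_succ_iff_lt_or_eq.1 hi with hi | rfl
    exacts [h i hi, h']
  · exact fun h => ⟨fun i hi => h i (by omega), h f (by omega)⟩

theorem block_anti {k f g : ℕ} (h : f ≤ g) : (block g : Set (Leaf n k)) ⊆ block f :=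
  fun _ hv i hi => hv i (by omega)

theorem block_succ_of_le {k f : ℕ} (h : k ≤ f) :
    (block (f + 1) : Set (Leaf n k)) = block f := by
  refine Set.Subset.antisymm (block_anti (by omega)) fun v hv i hi => ?_
  rcases Nat.lt_succ_iff_lt_or_eq.1 hi with hi | rfl
  exacts [hv i hi, entry_eq_none_of_le v h]

theorem part_subset_block {k f : ℕ} (μ : Option (Outer n)) :
    (part f μ : Set (Leaf n k)) ⊆ block f := fun _ h => h.1

/-- A nonzero letter ends the sequence, so nothing behind it remains to be chosen. -/
theorem eq_of_mem_part_some {k f : ℕ} {c : Outer n} {v w : Leaf n k}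
    (hv : v ∈ part f (some c)) (hw : w ∈ part f (some c)) : v = w := by
  refine ext_entry fun i => ?_
  rcases lt_trichotomy i f with hi | rfl | hi
  · rw [hv.1 i hi, hw.1 i hi]
  · rw [hv.2, hw.2]
  · rw [entry_eq_none_of_some v hv.2 hi, entry_eq_none_of_some w hw.2 hi]

theorem eq_of_mem_block {k : ℕ} {v w : Leaf n k} (hv : v ∈ block k) (hw : w ∈ block k) :
    v = w := by
  refine ext_entry fun i => ?_
  by_cases hi : i < k
  · rw [hv i hi, hw i hi]
  · rw [entry_eq_none_of_le v (by omega), entry_eq_none_of_le w (by omega)]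

theorem eq_of_mem_part_last {k f : ℕ} (hf : f + 1 = k) {μ : Option (Outer n)} {v w : Leaf n k}
    (hv : v ∈ part f μ) (hw : w ∈ part f μ) : v = w := by
  cases μ with
  | none =>
    rw [part_none, hf] at hv hw
    exact eq_of_mem_block hv hw
  | some c => exact eq_of_mem_part_some hv hw

theorem exists_mem_block (k f : ℕ) : ∃ v : Leaf n k, v ∈ block f := by
  induction k generalizing f with
  | zero => exact ⟨nil, fun i _ => by simp⟩
  | succ k ih =>
    cases f with
    | zero => exact ⟨zero (ih 0).choose, by simp⟩
    | succ f => exact ⟨zero (ih f).choose, by simpa using (ih f).choose_spec⟩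

theorem exists_mem_part {k f : ℕ} (hf : f < k) (μ : Option (Outer n)) :
    ∃ v : Leaf n k, v ∈ part f μ := by
  cases μ with
  | none => rw [part_none]; exact exists_mem_block k (f + 1)
  | some c =>
    induction k generalizing f with
    | zero => omega
    | succ k ih =>
      cases f with
      | zero => exact ⟨out c, by simp⟩
      | succ f =>
        obtain ⟨v, hv⟩ := ih (f := f) (by omega)
        exact ⟨zero v, by simpa using hv⟩

end Leaf

namespace Leaf

variable {n : ℕ}

theorem toSeq_eq_zero_iff (v : Leaf n 1) : v.toSeq = [0] ↔ v.entry 0 = none := by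
  rcases v with _ | c | v
  · simp [toSeq, c.2]
  · cases v; simp [toSeq]

theorem toSeq_eq_one_iff (c₁ : Outer n) (hc : (c₁.1 : ℕ) = 1) (v : Leaf n 1) :
    v.toSeq = [1] ↔ v.entry 0 = some c₁ := by
  rcases v with _ | c | v
  · simp [toSeq, ← hc, Subtype.ext_iff, Fin.ext_iff]
  · cases v; simp [toSeq]

end Leaf

/-- The letter encoding an element of the two-element field. -/
def bitLetter {n : ℕ} (c₁ : Outer n) (y : ZMod 2) : Option (Outer n) :=
  if y = 0 then none else some c₁

theorem OuterSym.exists_perm {n l : ℕ} (θ : OuterSym n l) (i j : Fin l) :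
    ∃ σ : Equiv.Perm (Outer n), ∀ s, θ.Rel s → σ (s i) = s j := by
  cases θ with
  | subset Y => exact ⟨1, fun s _ => by rw [Subsingleton.elim i j]; rfl⟩
  | perm σ =>
    fin_cases i <;> fin_cases j
    · exact ⟨1, fun s _ => rfl⟩
    · exact ⟨σ, fun s h => h⟩
    · exact ⟨σ.symm, fun s h => σ.symm_apply_eq.2 (Eq.symm h)⟩
    · exact ⟨1, fun s _ => rfl⟩
  | eqThree =>
    refine ⟨1, fun s h => ?_⟩
    have h' : s 0 = s 1 ∧ s 1 = s 2 := h
    fin_cases i <;> fin_cases j <;> simp [h'.1, h'.2]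

/-! ### How the relations of `𝔓^{n,k}` act on letters -/

namespace TauSym

variable {n : ℕ}

/-- The number of outer letters on which a symbol acts letterwise. -/
def coreDepth : {k l : ℕ} → TauSym n k l → ℕ
  | _, _, pair ρ _ => ρ.coreDepth + 1
  | _, _, _ => 0

theorem coreDepth_le {k l : ℕ} (ρ : TauSym n k l) : ρ.coreDepth ≤ k := by
  induction ρ with
  | pair ρ θ ih => simpa [coreDepth] using ih
  | _ => simp [coreDepth]

theorem arity_pos {k l : ℕ} (ρ : TauSym n k l) : 0 < l := by
  induction ρ with
  | pair ρ θ ih => exact ih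
  | _ => simp

theorem arity_le {k l : ℕ} (ρ : TauSym n k l) : l ≤ 3 := by
  induction ρ with
  | pair ρ θ ih => exact ih
  | _ => simp

/-- A tuple of a `pair` symbol lies entirely in the zero branch or entirely in `O_n`, so down to the
core all its entries leave the zero branch at the same depth. -/
theorem rel_block {k l : ℕ} (ρ : TauSym n k l) {f : ℕ} (hf : f ≤ ρ.coreDepth)
    {q : Fin l → Leaf n k} (hq : ρ.Rel q) {i : Fin l} (hi : q i ∈ Leaf.block f) (j : Fin l) :
    q j ∈ Leaf.block f := by
  induction ρ generalizing f with
  | pair ρ θ ih =>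
    cases f with
    | zero => simp
    | succ f =>
      rcases hq with ⟨s, hs, rfl⟩ | ⟨s, hs, rfl⟩
      · simp only [Leaf.zero_mem_block_succ] at hi ⊢
        exact ih (by simpa [coreDepth] using hf) hs hi j
      · simp at hi
  | _ =>
    obtain rfl : f = 0 := by simpa [coreDepth] using hf
    simp

/-- Above the core, the letter is governed by a symbol of `𝔒_n`, any two coordinates of which are
related by a permutation. The letter `0` is fixed because zero and outer entries never mix in a
tuple. -/
theorem exists_perm {k l : ℕ} (ρ : TauSym n k l) {f : ℕ} (hf : f < ρ.coreDepth) (i j : Fin l) :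
    ∃ π : Equiv.Perm (Option (Outer n)), π none = none ∧ ∀ μ q, ρ.Rel q →
      (q i ∈ Leaf.part f μ ↔ q j ∈ Leaf.part f (π μ)) := by
  induction ρ generalizing f with
  | pair ρ θ ih =>
    cases f with
    | zero =>
      obtain ⟨σ, hσ⟩ := θ.exists_perm i j
      refine ⟨Equiv.optionCongr σ, rfl, fun μ q hq => ?_⟩
      rcases hq with ⟨s, hs, rfl⟩ | ⟨s, hs, rfl⟩
      · cases μ <;> simp
      · cases μ <;> simp [← hσ s hs]
    | succ f =>
      obtain ⟨π, h0, hπ⟩ := ih (f := f) (by simpa [coreDepth] using hf) i j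
      refine ⟨π, h0, fun μ q hq => ?_⟩
      rcases hq with ⟨s, hs, rfl⟩ | ⟨s, hs, rfl⟩
      · simpa using hπ μ s hs
      · simp
  | _ => simp [coreDepth] at hf

/-- `ρ` acts behind its outer letters as the relation `transfer`. -/
def IsTransfer {k l : ℕ} (ρ : TauSym n k l) (i j : Fin l) : Prop :=
  (∀ m, m = i ∨ m = j) ∧ ρ.coreDepth < k ∧ ∀ f, ρ.coreDepth ≤ f → ∀ μ q, ρ.Rel q →
    (q i ∈ Leaf.part (f + 1) μ ↔ q j ∈ Leaf.part f μ)

/-- `ρ` acts on the last letter by permutations. -/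
def IsSwap {k l : ℕ} (ρ : TauSym n k l) : Prop :=
  ρ.coreDepth + 1 = k ∧ ∀ i j, ∃ π : Equiv.Perm (Option (Outer n)), ∀ μ q, ρ.Rel q →
    (q i ∈ Leaf.part ρ.coreDepth μ ↔ q j ∈ Leaf.part ρ.coreDepth (π μ))

/-- `ρ` acts on the last letter as a linear equation. -/
def IsLin (c₁ : Outer n) {k l : ℕ} (ρ : TauSym n k l) : Prop :=
  ρ.coreDepth + 1 = k ∧ ∃ e : Fin 3 → Fin l, Function.Surjective e ∧
    ∀ q : Fin l → Leaf n k,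
      (ρ.Rel q ∧ q (e 0) ∈ Leaf.block ρ.coreDepth) ↔
        ∃ y : Fin 3 → ZMod 2, y 0 + y 1 + y 2 = 1 ∧
          ∀ m, q (e m) ∈ Leaf.part ρ.coreDepth (bitLetter c₁ (y m))

theorem pair_rel_zero_iff {k l : ℕ} (hl : 0 < l) (ρ : TauSym n k l) (θ : OuterSym n l)
    (s : Fin l → Leaf n k) :
    (pair ρ θ).Rel (fun i => Leaf.zero (s i)) ↔ ρ.Rel s := by
  constructor
  · rintro (⟨s', hs, h⟩ | ⟨s', hs, h⟩)
    · have : s = s' := funext fun i => by simpa using congrFun h i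
      rwa [this]
    · simpa using congrFun h ⟨0, hl⟩
  · exact fun h => Or.inl ⟨s, h, rfl⟩

theorem exists_eq_zero {k l f : ℕ} {q : Fin l → Leaf n (k + 1)}
    (h : ∀ i, q i ∈ Leaf.block (f + 1)) :
    ∃ s : Fin l → Leaf n k, q = fun i => Leaf.zero (s i) := by
  have : ∀ i, ∃ v, q i = Leaf.zero v := fun i => by
    have := h i
    cases hq : q i with
    | out c => rw [hq] at this; simp at this
    | zero v => exact ⟨v, rfl⟩
  choose s hs using this
  exact ⟨s, funext hs⟩

/-- Stripping all `pair`s leaves a core symbol: `full`, a relation on `P^{n,0}`, `transfer`, `swap`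
or `lin`, in the order of the disjuncts. Each property survives a further `pair`, since the added
outer tuples do not meet the blocks in question. -/
theorem core_cases (c₁ : Outer n) (hc : (c₁.1 : ℕ) = 1) {k l : ℕ} (ρ : TauSym n k l) :
    (∀ q : Fin l → Leaf n k, (∀ i, q i ∈ Leaf.block ρ.coreDepth) → ρ.Rel q) ∨
      ρ.coreDepth = k ∨ (∃ i j, ρ.IsTransfer i j) ∨ ρ.IsSwap ∨ ρ.IsLin c₁ := by
  induction ρ with
  | full => exact Or.inl fun _ _ => trivial
  | empty => exact Or.inr (Or.inl rfl)
  | point => exact Or.inr (Or.inl rfl)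
  | eqTwo => exact Or.inr (Or.inl rfl)
  | eqThree => exact Or.inr (Or.inl rfl)
  | transfer =>
    refine Or.inr (Or.inr (Or.inl ⟨0, 1, fun m => by fin_cases m <;> simp, by simp [coreDepth],
      fun f _ μ q hq => ?_⟩))
    obtain ⟨v, h0, h1⟩ := hq
    rw [h0, h1, Leaf.zero_mem_part_succ]
    simp [Leaf.part, Leaf.block]
  | swap =>
    refine Or.inr (Or.inr (Or.inr (Or.inl ⟨rfl, fun i j => ?_⟩)))
    have key : ∀ μ q, (swap : TauSym n 1 2).Rel q →
        (q 0 ∈ Leaf.part 0 μ ↔ q 1 ∈ Leaf.part 0 (Equiv.swap none (some c₁) μ)) := by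
      intro μ q hq
      have : (q 1).entry 0 = Equiv.swap none (some c₁) ((q 0).entry 0) := by
        rcases hq with ⟨h0, h1⟩ | ⟨h0, h1⟩ | ⟨h0, h0', h1⟩
        · rw [(Leaf.toSeq_eq_zero_iff _).1 h0, (Leaf.toSeq_eq_one_iff c₁ hc _).1 h1]; simp
        · rw [(Leaf.toSeq_eq_zero_iff _).1 h1, (Leaf.toSeq_eq_one_iff c₁ hc _).1 h0]; simp
        · rw [h1, Equiv.swap_apply_of_ne_of_ne]
          · intro h; exact h0 ((Leaf.toSeq_eq_zero_iff _).2 h)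
          · intro h; exact h0' ((Leaf.toSeq_eq_one_iff c₁ hc _).2 h)
      rw [Leaf.mem_part_zero, Leaf.mem_part_zero, this, EmbeddingLike.apply_eq_iff_eq]
    fin_cases i <;> fin_cases j
    · exact ⟨1, fun μ s _ => Iff.rfl⟩
    · exact ⟨_, key⟩
    · refine ⟨Equiv.swap none (some c₁), fun μ q hq => ?_⟩
      have := key (Equiv.swap none (some c₁) μ) q hq
      rw [Equiv.swap_apply_self] at this
      exact this.symm
    · exact ⟨1, fun μ s _ => Iff.rfl⟩
  | lin =>
    refine Or.inr (Or.inr (Or.inr (Or.inr ⟨rfl, id, Function.surjective_id, fun q => ?_⟩)))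
    simp only [id, coreDepth, Leaf.mem_part_zero, Leaf.mem_block_zero, and_true]
    have h0 := fun v : Leaf n 1 => Leaf.toSeq_eq_zero_iff v
    have h1 := fun v : Leaf n 1 => Leaf.toSeq_eq_one_iff c₁ hc v
    have hrel : (lin : TauSym n 1 3).Rel q ↔
        ((q 0).entry 0 = some c₁ ∧ (q 1).entry 0 = some c₁ ∧ (q 2).entry 0 = some c₁) ∨
        ((q 0).entry 0 = some c₁ ∧ (q 1).entry 0 = none ∧ (q 2).entry 0 = none) ∨
        ((q 0).entry 0 = none ∧ (q 1).entry 0 = some c₁ ∧ (q 2).entry 0 = none) ∨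
        ((q 0).entry 0 = none ∧ (q 1).entry 0 = none ∧ (q 2).entry 0 = some c₁) := by
      simp only [← h0, ← h1, TauSym.Rel, Set.mem_insert_iff, Set.mem_singleton_iff, Prod.mk.injEq]
    rw [hrel]
    have hb0 : bitLetter c₁ 0 = none := by simp [bitLetter]
    have hb1 : bitLetter c₁ 1 = some c₁ := by simp [bitLetter]
    constructor
    · rintro (⟨a, b, c⟩ | ⟨a, b, c⟩ | ⟨a, b, c⟩ | ⟨a, b, c⟩)
      · exact ⟨![1, 1, 1], by decide, by simp [Fin.forall_fin_succ, a, b, c, hb1]⟩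
      · exact ⟨![1, 0, 0], by decide, by simp [Fin.forall_fin_succ, a, b, c, hb0, hb1]⟩
      · exact ⟨![0, 1, 0], by decide, by simp [Fin.forall_fin_succ, a, b, c, hb0, hb1]⟩
      · exact ⟨![0, 0, 1], by decide, by simp [Fin.forall_fin_succ, a, b, c, hb0, hb1]⟩
    · rintro ⟨y, hy, h⟩
      rw [h 0, h 1, h 2]
      have key : ∀ y : ZMod 2, y = 0 ∨ y = 1 := by decide
      rcases key (y 0) with e0 | e0 <;> rcases key (y 1) with e1 | e1 <;>
        rcases key (y 2) with e2 | e2 <;> rw [e0, e1, e2] at hy ⊢ <;>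
        first | (exact absurd hy (by decide)) | simp [hb0, hb1]
  | pair ρ θ ih =>
    have hl := ρ.arity_pos
    rcases ih with h | h | ⟨i, j, h1, h2, h3⟩ | ⟨h1, h2⟩ | ⟨h1, e, he, h⟩
    · refine Or.inl fun q hq => ?_
      obtain ⟨s, rfl⟩ := exists_eq_zero hq
      rw [pair_rel_zero_iff hl]
      exact h s fun i => by simpa [coreDepth] using hq i
    · exact Or.inr (Or.inl (by simpa [coreDepth] using h))
    · refine Or.inr (Or.inr (Or.inl ⟨i, j, h1, by simpa [coreDepth] using h2,
        fun f hf μ q hq => ?_⟩))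
      obtain ⟨f, rfl⟩ : ∃ g, f = g + 1 := ⟨f - 1, by simp [coreDepth] at hf; omega⟩
      rcases hq with ⟨s, hs, rfl⟩ | ⟨s, hs, rfl⟩
      · simpa using h3 f (by simpa [coreDepth] using hf) μ s hs
      · simp
    · refine Or.inr (Or.inr (Or.inr (Or.inl ⟨by simpa [coreDepth] using h1, fun i j => ?_⟩)))
      obtain ⟨π, hπ⟩ := h2 i j
      refine ⟨π, fun μ q hq => ?_⟩
      rcases hq with ⟨s, hs, rfl⟩ | ⟨s, hs, rfl⟩
      · simpa [coreDepth] using hπ μ s hs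
      · simp [coreDepth]
    · refine Or.inr (Or.inr (Or.inr (Or.inr ⟨by simpa [coreDepth] using h1, e, he,
        fun q => ?_⟩)))
      constructor
      · rintro ⟨⟨s, hs, rfl⟩ | ⟨s, hs, rfl⟩, hb⟩
        · simpa [coreDepth] using (h s).1 ⟨hs, by simpa [coreDepth] using hb⟩
        · simp [coreDepth] at hb
      · rintro ⟨y, hy, hq⟩
        obtain ⟨s, rfl⟩ : ∃ s : Fin _ → Leaf n _, q = fun i => Leaf.zero (s i) :=
          exists_eq_zero (f := ρ.coreDepth) fun i => by
            obtain ⟨m, rfl⟩ := he i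
            exact (hq m).1
        rw [pair_rel_zero_iff hl]
        simpa [coreDepth] using (h s).2 ⟨y, hy, by simpa [coreDepth] using hq⟩

end TauSym

/-! ### Stages that propagate relations over a finite template -/

/-- The ordinary IDBs of a propagation stage: a symbol for every `4`-ary relation on the domain of
the template, and a goal symbol. -/
inductive WalkSym (P : Type) : ℕ → Type
  | rel (Q : Set (Fin 4 → P)) : WalkSym P 4
  | goal : WalkSym P 0

/-- The ordinary IDBs of a propagation stage, together with copies of the EDBs. -/
abbrev WalkIdb (E : ℕ → Type) (P : Type) (l : ℕ) : Type := E l ⊕ WalkSym P l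

/-- The data of the `4`-ary propagated IDBs: a relation or a linear equation. -/
abbrev PropFact (P : Type) : Type := Set (Fin 4 → P) ⊕ ((Fin 3 → ZMod 2) × ZMod 2)

section Propagation

variable {E : ℕ → Type} {P : Type}

/-- The IDB that belongs to a fact. -/
def PropFact.sym : PropFact P → StageIdb (WalkIdb E P) 1 4
  | .inl Q => .inl (.inr (.rel Q))
  | .inr ab => .inr (EqnSym.eqn (k := 1) ab.1 ab.2)

/-- The relation on the template for which an equation stands: if the parameter is in `D`, then
the other entries are in `Z`, and their values satisfy the equation. -/
def eqnRel (D Z : Set P) (ξ : P → ZMod 2) (a : Fin 3 → ZMod 2) (b : ZMod 2) :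
    Set (Fin 4 → P) :=
  {q | q 0 ∈ D → (q 1 ∈ Z ∧ q 2 ∈ Z ∧ q 3 ∈ Z) ∧
    a 0 * ξ (q 1) + a 1 * ξ (q 2) + a 2 * ξ (q 3) = b}

/-- The relation on the template for which a fact stands. -/
def PropFact.meaning (D Z : Set P) (ξ : P → ZMod 2) : PropFact P → Set (Fin 4 → P)
  | .inl Q => Q
  | .inr ab => eqnRel D Z ξ ab.1 ab.2

/-- The relations on the template for which the IDBs stand. -/
def idbRel (𝔅 : (relLang E).Structure P) (D Z : Set P) (ξ : P → ZMod 2) :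
    (l : ℕ) → StageIdb (WalkIdb E P) 1 l → (Fin l → P) → Prop
  | _, .inl (.inl e), t => 𝔅.RelMap e t
  | _, .inl (.inr (.rel Q)), t => t ∈ Q
  | _, .inl (.inr .goal), _ => False
  | _, .inr (.eqn a b), t => (t : Fin 4 → P) ∈ eqnRel D Z ξ a b

theorem idbRel_sym (𝔅 : (relLang E).Structure P) (D Z : Set P) (ξ : P → ZMod 2) (j : PropFact P)
    (t : Fin 4 → P) : idbRel 𝔅 D Z ξ 4 j.sym t ↔ t ∈ j.meaning D Z ξ := by
  cases j <;> rfl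

/-- The rules with an IDB in the body: all those whose head and body are equivalent over the
template. -/
def walkRules (𝔅 : (relLang E).Structure P) (D Z : Set P) (ξ : P → ZMod 2) :
    Set (Rule E (StageIdb (WalkIdb E P) 1)) :=
  {r | ∃ (s s' : Fin 4 → Fin 7) (edb : List (EdbAtom E 7)) (j j' : PropFact P),
    r = ⟨7, ⟨4, j.sym, s⟩, edb, [⟨4, j'.sym, s'⟩]⟩ ∧ edb.length ≤ 1 ∧
      ∀ g : Fin 7 → P, (∀ a ∈ edb, a.Holds 𝔅 g) →
        (g ∘ s ∈ j.meaning D Z ξ ↔ g ∘ s' ∈ j'.meaning D Z ξ)}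

/-- The rule that starts the propagation. -/
def initRule (E : ℕ → Type) (P : Type) : Rule E (StageIdb (WalkIdb E P) 1) :=
  ⟨4, ⟨4, PropFact.sym (.inl Set.univ), id⟩, [], []⟩

/-- The rule that copies an EDB. -/
def copyRule (P : Type) (e : Σ l, E l) : Rule E (StageIdb (WalkIdb E P) 1) :=
  ⟨e.1, ⟨e.1, .inl (.inl e.2), id⟩, [.rel ⟨e.1, e.2, id⟩], []⟩

/-- The rules of a propagation stage. -/
def stageRules (𝔅 : (relLang E).Structure P) (D Z : Set P) (ξ : P → ZMod 2) :
    Set (Rule E (StageIdb (WalkIdb E P) 1)) :=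
  walkRules 𝔅 D Z ξ ∪ ({initRule E P} ∪ Set.range (copyRule P))

theorem finite_sigma_sum {F G : ℕ → Type} [Finite (Σ l, F l)] [Finite (Σ l, G l)] :
    Finite (Σ l, F l ⊕ G l) := by
  refine Finite.of_surjective
    (Sum.elim (fun x : Σ l, F l => ⟨x.1, .inl x.2⟩) (fun x : Σ l, G l => ⟨x.1, .inr x.2⟩)) ?_
  rintro ⟨l, x | x⟩
  exacts [⟨.inl ⟨l, x⟩, rfl⟩, ⟨.inr ⟨l, x⟩, rfl⟩]

instance [Finite P] : Finite (Σ l, WalkSym P l) := by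
  refine Finite.of_surjective (α := Option (Set (Fin 4 → P)))
    (fun o => o.elim ⟨0, .goal⟩ fun Q => ⟨4, .rel Q⟩) ?_
  rintro ⟨_, Q | _⟩
  exacts [⟨some Q, rfl⟩, ⟨none, rfl⟩]

instance (k : ℕ) : Finite (Σ l, SatSym k l) := by
  refine Finite.of_surjective (α := Bool) (fun o => ⟨k, if o then .top else .bot⟩) ?_
  rintro ⟨_, _ | _⟩
  exacts [⟨true, rfl⟩, ⟨false, rfl⟩]

theorem finite_edbAtom [Finite (Σ l, E l)] (v : ℕ) : Finite (EdbAtom E v) := by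
  refine Finite.of_surjective
    (α := (Σ e : (Σ l, E l), (Fin e.1 → Fin v)) ⊕ (Fin v × Fin v))
    (Sum.elim (fun x => .rel ⟨x.1.1, x.1.2, x.2⟩) fun x => .eq x.1 x.2) ?_
  rintro (⟨l, e, x⟩ | ⟨x, y⟩)
  exacts [⟨.inl ⟨⟨l, e⟩, x⟩, rfl⟩, ⟨.inr (x, y), rfl⟩]

theorem finite_stageRules [Finite (Σ l, E l)] [Finite P] (𝔅 : (relLang E).Structure P)
    (D Z : Set P) (ξ : P → ZMod 2) : (stageRules 𝔅 D Z ξ).Finite := by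
  refine Set.Finite.union ?_ ((Set.finite_singleton _).union (Set.finite_range _))
  have := finite_edbAtom (E := E) 7
  have hl : {l : List (EdbAtom E 7) | l.length ≤ 1}.Finite := List.finite_length_le _ 1
  have := hl.to_subtype
  refine (Set.finite_range fun x : ((Fin 4 → Fin 7) × (Fin 4 → Fin 7)) ×
    {l : List (EdbAtom E 7) | l.length ≤ 1} × (PropFact P × PropFact P) =>
    (⟨7, ⟨4, x.2.2.1.sym, x.1.1⟩, x.2.1.1, [⟨4, x.2.2.2.sym, x.1.2⟩]⟩ :
      Rule E (StageIdb (WalkIdb E P) 1))).subset ?_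
  rintro r ⟨s, s', edb, j, j', rfl, h, -⟩
  exact ⟨((s, s'), ⟨edb, h⟩, (j, j')), rfl⟩

/-- The stage that propagates relations under the assumption that the parameter is in `D`. -/
@[reducible] def walkStage [Finite (Σ l, E l)] [Finite P] (𝔅 : (relLang E).Structure P)
    (D Z : Set P) (ξ : P → ZMod 2) : Stage E where
  Idb := WalkIdb E P
  finite_idb := finite_sigma_sum
  param := 1
  rules := stageRules 𝔅 D Z ξ
  finite_rules := finite_stageRules 𝔅 D Z ξ

theorem linearRules_stageRules (𝔅 : (relLang E).Structure P) (D Z : Set P) (ξ : P → ZMod 2) :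
    LinearRules (stageRules 𝔅 D Z ξ) := by
  rintro r (⟨s, s', edb, j, j', rfl, -, -⟩ | rfl | ⟨e, rfl⟩)
  · exact le_rfl
  · exact zero_le_one
  · exact zero_le_one

theorem EdbAtom.rename_refl {v : ℕ} : EdbAtom.rename (E := E) (Equiv.refl (Fin v)) = id := by
  funext a
  cases a <;> rfl

/-- The defining condition of `walkRules` is an equivalence, so exchanging head and body gives a
rule of the same set. -/
theorem symmetricRules_stageRules (𝔅 : (relLang E).Structure P) (D Z : Set P)
    (ξ : P → ZMod 2) : SymmetricRules (stageRules 𝔅 D Z ξ) := by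
  rintro r (⟨s, s', edb, j, j', rfl, hl, h⟩ | rfl | ⟨e, rfl⟩) q hq
  · obtain rfl : _ = q := List.singleton_inj.1 hq
    refine ⟨⟨7, ⟨4, j'.sym, s'⟩, edb, [⟨4, j.sym, s⟩]⟩,
      .inl ⟨s', s, edb, j', j, rfl, hl, fun g hg => (h g hg).symm⟩, Equiv.refl _, rfl, rfl, ?_⟩
    rw [EdbAtom.rename_refl, List.map_id]
  · exact absurd hq (by simp [initRule])
  · exact absurd hq (by simp [copyRule])

/-- `h` maps all tuples of relations of `𝔄` to tuples of the same relations of `𝔅`. -/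
def IsRelHom {A B : Type} (𝔄 : (relLang E).Structure A) (𝔅 : (relLang E).Structure B)
    (h : A → B) : Prop :=
  ∀ l (e : E l) (t : Fin l → A), 𝔄.RelMap e t → 𝔅.RelMap e (h ∘ t)

theorem inCsp_iff {A B : Type} (𝔄 : (relLang E).Structure A) (𝔅 : (relLang E).Structure B) :
    InCsp 𝔅 𝔄 ↔ ∃ h, IsRelHom 𝔄 𝔅 h := by
  constructor
  · rintro ⟨h⟩
    exact ⟨h.toFun, fun l e t ht => h.map_rel' e t ht⟩
  · rintro ⟨h, hh⟩
    exact ⟨⟨h, fun f => f.elim, fun {l} e t ht => hh l e t ht⟩⟩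

variable {A : Type} {𝔄 : (relLang E).Structure A} {𝔅 : (relLang E).Structure P}
  {D Z : Set P} {ξ : P → ZMod 2}

theorem IsRelHom.edbAtom_holds {h : A → P} (hh : IsRelHom 𝔄 𝔅 h) {v : ℕ} {a : EdbAtom E v}
    {g : Fin v → A} (ha : a.Holds 𝔄 g) : a.Holds 𝔅 (h ∘ g) := by
  cases a with
  | rel a => exact hh _ _ _ ha
  | eq x y => exact congrArg h ha

/-- Soundness: the image of a rule instance under a homomorphism satisfies the EDB conjuncts over
the template, so truth passes from body to head. -/
theorem Derives.idbRel_comp {h : A → P} (hh : IsRelHom 𝔄 𝔅 h) {l : ℕ}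
    {I : StageIdb (WalkIdb E P) 1 l} {t : Fin l → A}
    (hd : Derives (stageRules 𝔅 D Z ξ) 𝔄 l I t) : idbRel 𝔅 D Z ξ l I (h ∘ t) := by
  induction hd with
  | step r hr g hedb hidb ih =>
    rcases hr with ⟨s, s', edb, j, j', rfl, hl, hs⟩ | rfl | ⟨e, rfl⟩
    · refine (idbRel_sym ..).2 ((hs (h ∘ g) fun a ha => hh.edbAtom_holds (hedb a ha)).2 ?_)
      exact (idbRel_sym ..).1 (ih _ (List.mem_singleton_self _))
    · exact Set.mem_univ _
    · exact hh _ _ _ (hedb _ (List.mem_singleton_self _))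

variable (𝔄 𝔅 D Z ξ)

/-- The tuple of elements belongs to the relation derived for a fact. -/
def Derived (j : PropFact P) (t : Fin 4 → A) : Prop :=
  Derives (stageRules 𝔅 D Z ξ) 𝔄 4 j.sym t

/-- The template for the output of a stage. -/
@[reducible] def outTemplate [Finite (Σ l, E l)] [Finite P] :
    (relLang (walkStage 𝔅 D Z ξ).Out).Structure P :=
  mkStr fun l R t => match l, R, t with
    | l, .inl I, t => idbRel 𝔅 D Z ξ l (.inl I) t
    | _, .inr .top, _ => True
    | _, .inr .bot, t => t (0 : Fin 1) ∉ D

variable {𝔄 𝔅 D Z ξ}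

theorem append_eq {u : Fin 1 → A} {v : Fin 3 → A} :
    (Fin.append u v : Fin 4 → A) = ![u 0, v 0, v 1, v 2] := by
  funext i
  fin_cases i <;> rfl

/-- The values `ξ ∘ h` solve the system. Hence `L^⊥(u)` forces `h u ∉ D`, which is how `outTemplate`
interprets it. -/
theorem IsRelHom.systemSat [Finite (Σ l, E l)] [Finite P] {h : A → P} (hh : IsRelHom 𝔄 𝔅 h)
    {u : Fin 1 → A} (hu : h (u 0) ∈ D) : (walkStage 𝔅 D Z ξ).SystemSat 𝔄 u := by
  refine ⟨fun a => ξ (h a), fun a b v hd => ?_⟩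
  have := hd.idbRel_comp hh
  exact (this hu).2

theorem IsRelHom.output [Finite (Σ l, E l)] [Finite P] {h : A → P} (hh : IsRelHom 𝔄 𝔅 h) :
    IsRelHom ((walkStage 𝔅 D Z ξ).output 𝔄) (outTemplate 𝔅 D Z ξ) h := by
  rintro l (I | I) t ht
  · exact Derives.idbRel_comp hh ht
  · cases I with
    | top => trivial
    | bot => exact fun hu => ht (hh.systemSat hu)

theorem output_copy [Finite (Σ l, E l)] [Finite P] {l : ℕ} {e : E l} {t : Fin l → A}
    (h : 𝔄.RelMap e t) : ((walkStage 𝔅 D Z ξ).output 𝔄).RelMap (.inl (.inl e)) t :=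
  Derives.step (copyRule P ⟨l, e⟩) (.inr (.inr ⟨_, rfl⟩)) t
    (fun a ha => by obtain rfl := List.mem_singleton.1 ha; exact h) (fun a ha => by cases ha)

theorem derived_univ (t : Fin 4 → A) : Derived 𝔄 𝔅 D Z ξ (.inl Set.univ) t :=
  Derives.step (initRule E P) (.inr (.inl rfl)) t (fun a ha => by cases ha)
    (fun a ha => by cases ha)

theorem Derived.step {j j' : PropFact P} {s s' : Fin 4 → Fin 7} (g : Fin 7 → A)
    (edb : List (EdbAtom E 7)) (hl : edb.length ≤ 1) (hedb : ∀ a ∈ edb, a.Holds 𝔄 g)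
    (hd : Derived 𝔄 𝔅 D Z ξ j' (g ∘ s'))
    (h : ∀ g : Fin 7 → P, (∀ a ∈ edb, a.Holds 𝔅 g) →
        (g ∘ s ∈ j.meaning D Z ξ ↔ g ∘ s' ∈ j'.meaning D Z ξ)) :
    Derived 𝔄 𝔅 D Z ξ j (g ∘ s) :=
  Derives.step (⟨7, ⟨4, j.sym, s⟩, edb, [⟨4, j'.sym, s'⟩]⟩ : Rule E (StageIdb (WalkIdb E P) 1))
    (.inl ⟨s, s', edb, j, j', rfl, hl, h⟩) g hedb
    (fun a ha => by obtain rfl := List.mem_singleton.1 ha; exact hd)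

end Propagation

/-! ### Walking along equivalent statements -/

section Nodes

variable {E : ℕ → Type} {P A : Type}

/-- A constraint of arity at most three links the statements `t i ∈ W` and `t j ∈ W'` if these are
equivalent for all tuples of its relation in the template. -/
def NodeStep (𝔄 : (relLang E).Structure A) (𝔅 : (relLang E).Structure P)
    (x y : A × Set P) : Prop :=
  ∃ (l : ℕ) (e : E l) (t : Fin l → A) (i j : Fin l), l ≤ 3 ∧ 𝔄.RelMap e t ∧ x.1 = t i ∧
    y.1 = t j ∧ ∀ q, 𝔅.RelMap e q → (q i ∈ x.2 ↔ q j ∈ y.2)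

/-- The equivalence of statements generated by the links. -/
def NodeEq (𝔄 : (relLang E).Structure A) (𝔅 : (relLang E).Structure P) :
    A × Set P → A × Set P → Prop :=
  Relation.EqvGen (NodeStep 𝔄 𝔅)

/-- The statement `a ∈ W` is equivalent to falsity. -/
def Refuted (𝔄 : (relLang E).Structure A) (𝔅 : (relLang E).Structure P) (a : A) (W : Set P) :
    Prop :=
  ∃ b, NodeEq 𝔄 𝔅 (a, W) (b, ∅)

variable {𝔄 : (relLang E).Structure A} {𝔅 : (relLang E).Structure P}
  {D Z : Set P} {ξ : P → ZMod 2}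

theorem NodeEq.symm {x y : A × Set P} (h : NodeEq 𝔄 𝔅 x y) : NodeEq 𝔄 𝔅 y x :=
  Relation.EqvGen.symm _ _ h

theorem NodeEq.trans {x y z : A × Set P} (h : NodeEq 𝔄 𝔅 x y) (h' : NodeEq 𝔄 𝔅 y z) :
    NodeEq 𝔄 𝔅 x z :=
  Relation.EqvGen.trans _ _ _ h h'

theorem NodeEq.refl (x : A × Set P) : NodeEq 𝔄 𝔅 x x := Relation.EqvGen.refl _

theorem NodeEq.of_rel {l : ℕ} {e : E l} (hl : l ≤ 3) {t : Fin l → A} (ht : 𝔄.RelMap e t)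
    {i j : Fin l} {W W' : Set P} (h : ∀ q, 𝔅.RelMap e q → (q i ∈ W ↔ q j ∈ W')) :
    NodeEq 𝔄 𝔅 (t i, W) (t j, W') :=
  Relation.EqvGen.rel _ _ ⟨l, e, t, i, j, hl, ht, rfl, rfl, h⟩

theorem Refuted.of_rel {l : ℕ} {e : E l} (hl : l ≤ 3) {t : Fin l → A} (ht : 𝔄.RelMap e t)
    {i : Fin l} {W : Set P} (h : ∀ q, 𝔅.RelMap e q → q i ∉ W) : Refuted 𝔄 𝔅 (t i) W :=
  ⟨t i, NodeEq.of_rel hl ht fun q hq => by simp [h q hq]⟩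

theorem NodeEq.refuted {x y : A × Set P} (h : NodeEq 𝔄 𝔅 x y) (hy : Refuted 𝔄 𝔅 y.1 y.2) :
    Refuted 𝔄 𝔅 x.1 x.2 :=
  ⟨_, h.trans hy.choose_spec⟩

/-- `R` holds for the second and third entry, and `X` holds for them if and only if the last entry
is in `W`, provided that the first entry is in `D`. -/
def walkRel (D : Set P) (R X : P → P → Prop) (W : Set P) : Set (Fin 4 → P) :=
  {q | q 0 ∈ D → R (q 1) (q 2) ∧ (X (q 1) (q 2) ↔ q 3 ∈ W)}

/-- The element at position `m` of the assignment that extends `w` by the tuple `t`. -/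
def extendTuple {l : ℕ} (w : Fin 4 → A) (t : Fin l → A) (m : Fin 7) : A :=
  if h : 4 ≤ m.1 ∧ m.1 - 4 < l then t ⟨m.1 - 4, h.2⟩ else w (Fin.ofNat 4 m.1)

/-- The variable for entry `i` of the tuple. -/
def tupleVar {l : ℕ} (hl : l ≤ 3) (i : Fin l) : Fin 7 := ⟨4 + i.1, by omega⟩

theorem extendTuple_tupleVar {l : ℕ} (hl : l ≤ 3) (w : Fin 4 → A) (t : Fin l → A) (i : Fin l) :
    extendTuple w t (tupleVar hl i) = t i := by
  simp [extendTuple, tupleVar]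

theorem Derived.of_rel {l : ℕ} {e : E l} (hl : l ≤ 3) {t : Fin l → A} (ht : 𝔄.RelMap e t)
    {j j' : PropFact P} {s s' : Fin 4 → Fin 7} {w w₁ w₂ : Fin 4 → A}
    (hd : Derived 𝔄 𝔅 D Z ξ j' w₁) (h₁ : w₁ = extendTuple w t ∘ s')
    (h₂ : w₂ = extendTuple w t ∘ s)
    (h : ∀ g : Fin 7 → P, 𝔅.RelMap e (fun i => g (tupleVar hl i)) →
        (g ∘ s ∈ j.meaning D Z ξ ↔ g ∘ s' ∈ j'.meaning D Z ξ)) :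
    Derived 𝔄 𝔅 D Z ξ j w₂ := by
  subst h₁ h₂
  refine Derived.step (extendTuple w t) [.rel ⟨l, e, tupleVar hl⟩] le_rfl ?_ hd ?_
  · intro a ha
    obtain rfl := List.mem_singleton.1 ha
    have : extendTuple w t ∘ tupleVar hl = t :=
      funext fun i => extendTuple_tupleVar hl w t i
    change 𝔄.RelMap e (extendTuple w t ∘ tupleVar hl)
    rwa [this]
  · exact fun g hg => h g (hg _ (List.mem_singleton_self _))

theorem Derived.of_meaning {j j' : PropFact P} {s s' : Fin 4 → Fin 4} (w : Fin 4 → A)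
    {w₁ w₂ : Fin 4 → A} (hd : Derived 𝔄 𝔅 D Z ξ j' w₁) (h₁ : w₁ = w ∘ s') (h₂ : w₂ = w ∘ s)
    (h : ∀ g : Fin 4 → P, (g ∘ s ∈ j.meaning D Z ξ ↔ g ∘ s' ∈ j'.meaning D Z ξ)) :
    Derived 𝔄 𝔅 D Z ξ j w₂ := by
  subst h₁ h₂
  have hw : ∀ s : Fin 4 → Fin 4, w ∘ s =
      (fun m : Fin 7 => w (Fin.ofNat 4 m.1)) ∘ fun i => Fin.castLE (by omega) (s i) := by
    intro s
    funext i
    exact congrArg w (Fin.ext (Nat.mod_eq_of_lt (s i).2).symm)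
  rw [hw] at hd ⊢
  exact Derived.step _ [] (Nat.zero_le _) (fun a ha => by cases ha) hd
    fun g _ => h fun i => g (Fin.castLE (by omega) i)

theorem Derived.walk_of_step {R X : P → P → Prop} {u b b' : A} {x y : A × Set P}
    (h : NodeStep 𝔄 𝔅 x y) :
    Derived 𝔄 𝔅 D Z ξ (.inl (walkRel D R X x.2)) ![u, b, b', x.1] ↔
      Derived 𝔄 𝔅 D Z ξ (.inl (walkRel D R X y.2)) ![u, b, b', y.1] := by
  obtain ⟨l, e, t, i, j, hl, ht, hx, hy, h⟩ := h
  have hw : ∀ i, (![u, b, b', t i] : Fin 4 → A) =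
      extendTuple ![u, b, b', u] t ∘ ![0, 1, 2, tupleVar hl i] := by
    intro i
    funext m
    fin_cases m
    · rfl
    · rfl
    · rfl
    · exact (extendTuple_tupleVar hl _ t i).symm
  rw [hx, hy]
  have key : ∀ g : Fin 7 → P, 𝔅.RelMap e (fun i => g (tupleVar hl i)) →
      (g ∘ ![0, 1, 2, tupleVar hl i] ∈ walkRel D R X x.2 ↔
        g ∘ ![0, 1, 2, tupleVar hl j] ∈ walkRel D R X y.2) := by
    intro g hg
    have := h _ hg
    simp only [walkRel, Set.mem_ofPred_eq, Function.comp_apply, Matrix.cons_val]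
    rw [this]
  exact ⟨fun hd => hd.of_rel hl ht (hw i) (hw j) fun g hg => (key g hg).symm,
    fun hd => hd.of_rel hl ht (hw j) (hw i) key⟩

/-- Each link is a reversible rule that moves only the fourth entry. The remembered part, `R` and
`X`, is untouched, so it can be combined with the end of the walk. -/
theorem Derived.walk {R X : P → P → Prop} {u b b' : A} {x y : A × Set P}
    (h : NodeEq 𝔄 𝔅 x y) :
    Derived 𝔄 𝔅 D Z ξ (.inl (walkRel D R X x.2)) ![u, b, b', x.1] ↔
      Derived 𝔄 𝔅 D Z ξ (.inl (walkRel D R X y.2)) ![u, b, b', y.1] := by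
  induction h with
  | rel x y h => exact Derived.walk_of_step h
  | refl x => exact Iff.rfl
  | symm x y _ ih => exact ih.symm
  | trans x y z _ _ ih ih' => exact ih.trans ih'

variable (𝔄 𝔅 D Z ξ)

/-- It is derived that the pair `(b, b')` satisfies `R`, provided that `u` is in `D`. -/
def Concluded (u b b' : A) (R : P → P → Prop) : Prop :=
  Derived 𝔄 𝔅 D Z ξ (.inl {q | q 0 ∈ D → R (q 1) (q 2)}) ![u, b, b', u]

variable {𝔄 𝔅 D Z ξ} {u b b' : A} {R R' X : P → P → Prop}

theorem concluded_true : Concluded 𝔄 𝔅 D Z ξ u b b' fun _ _ => True := by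
  have : {q : Fin 4 → P | q 0 ∈ D → True} = Set.univ := by ext; simp
  rw [Concluded, this]
  exact derived_univ _

/-- The added equivalence between `X` and membership in `V` is a tautology under the assumption on
the parameter, so adding it is reversible. -/
theorem Concluded.start (h : Concluded 𝔄 𝔅 D Z ξ u b b' R) (i : Fin 3) {V : Set P}
    (hX : ∀ q : Fin 3 → P, q 0 ∈ D → (X (q 1) (q 2) ↔ q i ∈ V)) :
    Derived 𝔄 𝔅 D Z ξ (.inl (walkRel D R X V)) ![u, b, b', ![u, b, b'] i] := by
  refine h.of_meaning ![u, b, b', u] (s' := ![0, 1, 2, 0])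
    (s := ![0, 1, 2, i.castSucc]) ?_ ?_ ?_
  · funext m; fin_cases m <;> rfl
  · funext m; fin_cases i <;> fin_cases m <;> rfl
  · intro g
    have := hX ![g 0, g 1, g 2]
    have hi : g i.castSucc = ![g 0, g 1, g 2] i := by fin_cases i <;> rfl
    simp only [PropFact.meaning, walkRel, Set.mem_ofPred_eq, Function.comp_apply,
      Matrix.cons_val, hi]
    refine forall_congr' fun h0 => ?_
    simp [← this h0]

theorem Derived.concluded {d : A} {W : Set P}
    (h : Derived 𝔄 𝔅 D Z ξ (.inl (walkRel D R X W)) ![u, b, b', d]) (i : Fin 3)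
    (hd : ![u, b, b'] i = d)
    (hR : ∀ q : Fin 3 → P, q 0 ∈ D →
      (R' (q 1) (q 2) ↔ R (q 1) (q 2) ∧ (X (q 1) (q 2) ↔ q i ∈ W))) :
    Concluded 𝔄 𝔅 D Z ξ u b b' R' := by
  subst hd
  refine h.of_meaning ![u, b, b', u] (s := ![0, 1, 2, 0])
    (s' := ![0, 1, 2, i.castSucc]) ?_ ?_ ?_
  · funext m; fin_cases i <;> fin_cases m <;> rfl
  · funext m; fin_cases m <;> rfl
  · intro g
    have := hR ![g 0, g 1, g 2]
    have hi : g i.castSucc = ![g 0, g 1, g 2] i := by fin_cases i <;> rfl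
    simp only [PropFact.meaning, walkRel, Set.mem_ofPred_eq, Function.comp_apply,
      Matrix.cons_val, hi]
    exact forall_congr' fun h0 => this h0

/-- A walk that ends in the empty set has shown `X` to be false; the end point can be forgotten. -/
theorem Derived.concluded_not {d : A}
    (h : Derived 𝔄 𝔅 D Z ξ (.inl (walkRel D R X ∅)) ![u, b, b', d])
    (hR : ∀ p p', R' p p' ↔ R p p' ∧ ¬ X p p') :
    Concluded 𝔄 𝔅 D Z ξ u b b' R' := by
  refine h.of_meaning ![u, b, b', d] (s := ![0, 1, 2, 0]) (s' := ![0, 1, 2, 3]) ?_ ?_ ?_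
  · funext m; fin_cases m <;> rfl
  · funext m; fin_cases m <;> rfl
  · intro g
    simp [PropFact.meaning, walkRel, hR]

/-- An equivalence of two statements about `b` and `b'` is added to the conclusion. -/
theorem Concluded.link (h : Concluded 𝔄 𝔅 D Z ξ u b b' R) {V V' : Set P}
    (hn : NodeEq 𝔄 𝔅 (b, V) (b', V')) :
    Concluded 𝔄 𝔅 D Z ξ u b b' fun p p' => R p p' ∧ (p ∈ V ↔ p' ∈ V') :=
  ((Derived.walk hn).1 (h.start (X := fun p _ => p ∈ V) 1 fun _ _ => Iff.rfl)).concluded 2 rfl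
    fun _ _ => Iff.rfl

theorem Concluded.link_left (h : Concluded 𝔄 𝔅 D Z ξ u b b' R) {V V' : Set P}
    (hn : NodeEq 𝔄 𝔅 (b, V) (b, V')) :
    Concluded 𝔄 𝔅 D Z ξ u b b' fun p p' => R p p' ∧ (p ∈ V ↔ p ∈ V') :=
  ((Derived.walk hn).1 (h.start (X := fun p _ => p ∈ V) 1 fun _ _ => Iff.rfl)).concluded 1 rfl
    fun _ _ => Iff.rfl

theorem Concluded.param_left (h : Concluded 𝔄 𝔅 D Z ξ u b b' R) {V : Set P}
    (hn : NodeEq 𝔄 𝔅 (u, D) (b, V)) :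
    Concluded 𝔄 𝔅 D Z ξ u b b' fun p p' => R p p' ∧ p ∈ V :=
  ((Derived.walk hn).1 (h.start (X := fun _ _ => True) 0 fun q hq => by simp [hq])).concluded
    1 rfl fun _ _ => by simp

theorem Concluded.param_right (h : Concluded 𝔄 𝔅 D Z ξ u b b' R) {V : Set P}
    (hn : NodeEq 𝔄 𝔅 (u, D) (b', V)) :
    Concluded 𝔄 𝔅 D Z ξ u b b' fun p p' => R p p' ∧ p' ∈ V :=
  ((Derived.walk hn).1 (h.start (X := fun _ _ => True) 0 fun q hq => by simp [hq])).concluded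
    2 rfl fun _ _ => by simp

theorem Concluded.refuted_left (h : Concluded 𝔄 𝔅 D Z ξ u b b' R) {V : Set P}
    (hn : Refuted 𝔄 𝔅 b V) :
    Concluded 𝔄 𝔅 D Z ξ u b b' fun p p' => R p p' ∧ p ∉ V :=
  ((Derived.walk hn.choose_spec).1
    (h.start (X := fun p _ => p ∈ V) 1 fun _ _ => Iff.rfl)).concluded_not fun _ _ => Iff.rfl

theorem Concluded.refuted_right (h : Concluded 𝔄 𝔅 D Z ξ u b b' R) {V : Set P}
    (hn : Refuted 𝔄 𝔅 b' V) :
    Concluded 𝔄 𝔅 D Z ξ u b b' fun p p' => R p p' ∧ p' ∉ V :=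
  ((Derived.walk hn.choose_spec).1
    (h.start (X := fun _ p => p ∈ V) 2 fun _ _ => Iff.rfl)).concluded_not fun _ _ => Iff.rfl

theorem Concluded.congr (h : Concluded 𝔄 𝔅 D Z ξ u b b' R)
    (hR : ∀ p p', R' p p' ↔ R p p') : Concluded 𝔄 𝔅 D Z ξ u b b' R' := by
  have : R' = R := by funext p p'; exact propext (hR p p')
  exact this ▸ h

variable (𝔄 𝔅 D Z ξ) in
/-- `x` satisfies all equations derived for the parameter `u`. -/
def IsSystemSolution (u : A) (x : A → ZMod 2) : Prop :=
  ∀ a β v₀ v₁ v₂, Derived 𝔄 𝔅 D Z ξ (.inr (a, β)) ![u, v₀, v₁, v₂] →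
    a 0 * x v₀ + a 1 * x v₁ + a 2 * x v₂ = β

theorem exists_isSystemSolution [Finite (Σ l, E l)] [Finite P] {u : Fin 1 → A}
    (h : (walkStage 𝔅 D Z ξ).SystemSat 𝔄 u) :
    ∃ x, IsSystemSolution 𝔄 𝔅 D Z ξ (u 0) x := by
  obtain ⟨x, hx⟩ := h
  refine ⟨x, fun a β v₀ v₁ v₂ hd => hx a β ![v₀, v₁, v₂] ?_⟩
  have := append_eq (u := u) (v := ![v₀, v₁, v₂])
  exact this.symm ▸ hd

variable {x : A → ZMod 2}

/-- A contradiction has the same meaning as the equation `0 = 1` under the parameter assumption, so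
the latter is derived. -/
theorem IsSystemSolution.not_false (hx : IsSystemSolution 𝔄 𝔅 D Z ξ u x)
    (h : Concluded 𝔄 𝔅 D Z ξ u b b' fun _ _ => False) : False := by
  have := hx ![0, 0, 0] 1 u u u <| h.of_meaning ![u, b, b', u] (s := ![0, 0, 0, 0])
    (s' := ![0, 1, 2, 0]) (by funext m; fin_cases m <;> rfl) (by funext m; fin_cases m <;> rfl)
    fun g => by simp [PropFact.meaning, eqnRel]
  simp at this

theorem IsSystemSolution.apply_eq (hx : IsSystemSolution 𝔄 𝔅 D Z ξ u x) {β : ZMod 2}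
    (h : Concluded 𝔄 𝔅 D Z ξ u b b' fun p _ => p ∈ Z ∧ ξ p = β) : x b = β := by
  have := hx ![1, 0, 0] β b b b <| h.of_meaning ![u, b, b', u] (s := ![0, 1, 1, 1])
    (s' := ![0, 1, 2, 0]) (by funext m; fin_cases m <;> rfl) (by funext m; fin_cases m <;> rfl)
    fun g => by simp [PropFact.meaning, eqnRel]
  simpa using this

theorem IsSystemSolution.add_eq (hx : IsSystemSolution 𝔄 𝔅 D Z ξ u x) {β : ZMod 2}
    (h : Concluded 𝔄 𝔅 D Z ξ u b b' fun p p' => p ∈ Z ∧ p' ∈ Z ∧ ξ p + ξ p' = β) :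
    x b + x b' = β := by
  have := hx ![1, 1, 0] β b b' b' <| h.of_meaning ![u, b, b', u] (s := ![0, 1, 2, 2])
    (s' := ![0, 1, 2, 0]) (by funext m; fin_cases m <;> rfl) (by funext m; fin_cases m <;> rfl)
    fun g => by simp [PropFact.meaning, eqnRel, and_assoc]
  simpa using this

/-- Walk from the parameter to one entry of the constraint. Given the constraint, membership of that
entry in `W` is equivalent to the equation together with membership in `Z`, so one rule produces the
equation. -/
theorem IsSystemSolution.add_add_eq (hx : IsSystemSolution 𝔄 𝔅 D Z ξ u x) {l : ℕ} {e : E l}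
    (hl : l ≤ 3) {t : Fin l → A} (ht : 𝔄.RelMap e t) {W : Set P} (m : Fin 3 → Fin l)
    (hn : NodeEq 𝔄 𝔅 (u, D) (t (m 0), W))
    (h : ∀ q, 𝔅.RelMap e q → (q (m 0) ∈ W ↔
      (q (m 0) ∈ Z ∧ q (m 1) ∈ Z ∧ q (m 2) ∈ Z) ∧ ξ (q (m 0)) + ξ (q (m 1)) + ξ (q (m 2)) = 1)) :
    x (t (m 0)) + x (t (m 1)) + x (t (m 2)) = 1 := by
  have hd := (Derived.walk hn).1 ((concluded_true (𝔄 := 𝔄) (𝔅 := 𝔅) (D := D) (Z := Z) (ξ := ξ)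
    (u := u) (b := u) (b' := u)).start (X := fun _ _ => True) 0 fun q hq => by simp [hq])
  have := hx ![1, 1, 1] 1 (t (m 0)) (t (m 1)) (t (m 2)) <| hd.of_rel hl ht
    (w := ![u, u, u, u]) (s' := ![0, 1, 2, tupleVar hl (m 0)])
    (s := ![0, tupleVar hl (m 0), tupleVar hl (m 1), tupleVar hl (m 2)]) ?_ ?_ ?_
  · simpa using this
  · funext i
    fin_cases i
    · rfl
    · rfl
    · rfl
    · exact (extendTuple_tupleVar hl _ t _).symm
  · funext i
    fin_cases i
    · rfl
    all_goals exact (extendTuple_tupleVar hl _ t _).symm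
  · intro g hg
    have := h _ hg
    simp only [PropFact.meaning, eqnRel, walkRel, Set.mem_ofPred_eq, Function.comp_apply,
      Matrix.cons_val, one_mul, true_and, true_iff]
    rw [this]

end Nodes

/-! ### Coherent choice of letters from a solution of the system -/

section Letters

variable {E : ℕ → Type} {P A L : Type}

/-- All the statements `d ∈ part d μ` are linked to the statements `d' ∈ part d' ν` by a
permutation of the letters. -/
def PartLinked (𝔄 : (relLang E).Structure A) (𝔅 : (relLang E).Structure P)
    (part : A → L → Set P) (d d' : A) : Prop :=
  ∃ π : Equiv.Perm L, ∀ μ, NodeEq 𝔄 𝔅 (d, part d μ) (d', part d' (π μ))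

theorem equivalence_partLinked (𝔄 : (relLang E).Structure A) (𝔅 : (relLang E).Structure P)
    (part : A → L → Set P) : Equivalence (PartLinked 𝔄 𝔅 part) where
  refl d := ⟨1, fun μ => NodeEq.refl _⟩
  symm := by
    rintro d d' ⟨π, h⟩
    refine ⟨π.symm, fun μ => ?_⟩
    have := h (π.symm μ)
    rw [Equiv.apply_symm_apply] at this
    exact this.symm
  trans := by
    rintro d d' d'' ⟨π, h⟩ ⟨π', h'⟩
    exact ⟨π.trans π', fun μ => (h μ).trans (h' _)⟩

/-- The letter `μ` is not excluded for `b` by the links. -/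
def Alive (𝔄 : (relLang E).Structure A) (𝔅 : (relLang E).Structure P) (D : Set P)
    (part : A → L → Set P) (u b : A) (μ : L) : Prop :=
  ¬ Refuted 𝔄 𝔅 b (part b μ) ∧
    (∀ ν, NodeEq 𝔄 𝔅 (b, part b μ) (b, part b ν) → ν = μ) ∧
    ∀ ν, NodeEq 𝔄 𝔅 (u, D) (b, part b ν) → ν = μ

variable {𝔄 : (relLang E).Structure A} {𝔅 : (relLang E).Structure P}
  {D Z : Set P} {ξ : P → ZMod 2} {part : A → L → Set P} {u : A} {x : A → ZMod 2}

/-- Non-alive letters are eliminated one by one. A refuted letter is removed directly. Otherwise it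
is linked to a different letter at `b`, or the assumption is linked to a different letter, and
disjointness of the parts excludes it. -/
theorem exists_concluded_disjoint [Finite L] {B : Set P} {b : A}
    (hdisj : ∀ μ ν p, p ∈ part b μ → p ∈ part b ν → μ = ν)
    (hB : NodeEq 𝔄 𝔅 (u, D) (b, B)) :
    ∃ S : Set P, Concluded 𝔄 𝔅 D Z ξ u b b (fun p _ => p ∈ S) ∧ S ⊆ B ∧
      ∀ μ, ¬ Alive 𝔄 𝔅 D part u b μ → ∀ p ∈ S, p ∉ part b μ := by
  classical
  have := Fintype.ofFinite L
  suffices h : ∀ M : Finset L, (∀ μ ∈ M, ¬ Alive 𝔄 𝔅 D part u b μ) →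
      ∃ S : Set P, Concluded 𝔄 𝔅 D Z ξ u b b (fun p _ => p ∈ S) ∧ S ⊆ B ∧
        ∀ μ ∈ M, ∀ p ∈ S, p ∉ part b μ by
    obtain ⟨S, h1, h2, h3⟩ := h {μ | ¬ Alive 𝔄 𝔅 D part u b μ} (by simp)
    exact ⟨S, h1, h2, fun μ hμ => h3 μ (by simpa using hμ)⟩
  intro M hM
  induction M using Finset.induction_on with
  | empty =>
    exact ⟨B, (concluded_true.param_left hB).congr fun p p' => by simp, subset_rfl, by simp⟩
  | insert μ M _ ih =>
    obtain ⟨S, h1, h2, h3⟩ := ih fun ν hν => hM ν (Finset.mem_insert_of_mem hν)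
    suffices h : ∃ S' : Set P, Concluded 𝔄 𝔅 D Z ξ u b b (fun p _ => p ∈ S') ∧ S' ⊆ S ∧
        ∀ p ∈ S', p ∉ part b μ by
      obtain ⟨S', h1', h2', h3'⟩ := h
      refine ⟨S', h1', h2'.trans h2, fun ν hν p hp => ?_⟩
      rcases Finset.mem_insert.1 hν with rfl | hν
      exacts [h3' p hp, h3 ν hν p (h2' hp)]
    have hμ := hM μ (Finset.mem_insert_self _ _)
    simp only [Alive, not_and_or, not_not, not_forall] at hμ
    rcases hμ with hμ | ⟨ν, hν, hne⟩ | ⟨ν, hν, hne⟩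
    · exact ⟨S \ part b μ, h1.refuted_left hμ, Set.sdiff_subset, fun p hp => hp.2⟩
    · exact ⟨{p | p ∈ S ∧ (p ∈ part b μ ↔ p ∈ part b ν)}, h1.link_left hν, fun p hp => hp.1,
        fun p hp h => hne (hdisj _ _ p (hp.2.1 h) h)⟩
    · exact ⟨S ∩ part b ν, h1.param_left hν, Set.inter_subset_left,
        fun p hp h => hne (hdisj _ _ p hp.2 h)⟩

/-- If no letter were alive, the elimination would leave nothing, and `0 = 1` would be derived. -/
theorem exists_alive [Finite L] {B : Set P} {b : A}
    (hdisj : ∀ μ ν p, p ∈ part b μ → p ∈ part b ν → μ = ν)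
    (hB : NodeEq 𝔄 𝔅 (u, D) (b, B)) (hpart : ∀ p ∈ B, ∃ μ, p ∈ part b μ)
    (hx : IsSystemSolution 𝔄 𝔅 D Z ξ u x) : ∃ μ, Alive 𝔄 𝔅 D part u b μ := by
  by_contra! hcon
  obtain ⟨S, h1, h2, h3⟩ := exists_concluded_disjoint (Z := Z) (ξ := ξ) hdisj hB
  refine hx.not_false (h1.congr fun p _ => ⟨False.elim, fun hp => ?_⟩)
  obtain ⟨μ, hμ⟩ := hpart p (h2 hp)
  exact h3 μ (hcon μ) p hp hμ

/-- Otherwise elimination leaves only the opposite bit, or nothing. The former puts `x b = x b + 1`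
into the system, the latter `0 = 1`. -/
theorem alive_of_solution [Finite L] {B : Set P} {b : A}
    (hdisj : ∀ μ ν p, p ∈ part b μ → p ∈ part b ν → μ = ν)
    (hB : NodeEq 𝔄 𝔅 (u, D) (b, B)) (hpart : ∀ p ∈ B, ∃ μ, p ∈ part b μ)
    (hx : IsSystemSolution 𝔄 𝔅 D Z ξ u x) {bit : ZMod 2 → L}
    (h₁ : ∀ μ, μ ∉ Set.range bit → Refuted 𝔄 𝔅 b (part b μ))
    (h₂ : ∀ y p, p ∈ part b (bit y) ↔ p ∈ Z ∧ ξ p = y)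
    (h₃ : ∀ y, (part b (bit y)).Subsingleton) : Alive 𝔄 𝔅 D part u b (bit (x b)) := by
  by_contra hcon
  obtain ⟨S, h1, h2, h3⟩ := exists_concluded_disjoint (Z := Z) (ξ := ξ) hdisj hB
  have hS : S ⊆ part b (bit (x b + 1)) := by
    intro p hp
    obtain ⟨μ, hμ⟩ := hpart p (h2 hp)
    by_cases hr : μ ∈ Set.range bit
    · obtain ⟨y, rfl⟩ := hr
      have hy : ∀ y z : ZMod 2, y = z ∨ y = z + 1 := by decide
      rcases hy y (x b) with rfl | rfl
      exacts [absurd hμ (h3 _ hcon p hp), hμ]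
    · exact absurd hμ (h3 μ (fun h => h.1 (h₁ μ hr)) p hp)
  rcases S.eq_empty_or_nonempty with rfl | ⟨p₀, hp₀⟩
  · exact hx.not_false h1
  · have := hx.apply_eq (b := b) (b' := b) (β := x b + 1) <| h1.congr fun p _ => by
      rw [← h₂]
      exact ⟨fun hp => h₃ _ hp (hS hp₀) ▸ hp₀, fun hp => hS hp⟩
    generalize x b = z at this
    revert z
    decide

/-- Letters that respect all permutations of letters which come from links, are not refuted, and
are given on `Λ` by a solution of the linear equations. -/
theorem exists_letters [Finite L] {V Λ : Set A} {B : A → Set P}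
    (hdisj : ∀ d μ ν p, p ∈ part d μ → p ∈ part d ν → μ = ν)
    (hsub : ∀ d μ, part d μ ⊆ B d) (hpart : ∀ d, ∀ p ∈ B d, ∃ μ, p ∈ part d μ)
    (hB : ∀ d ∈ V, NodeEq 𝔄 𝔅 (u, D) (d, B d))
    (hx : IsSystemSolution 𝔄 𝔅 D Z ξ u x) {bit : ZMod 2 → L} (hΛ : Λ ⊆ V)
    (h₁ : ∀ d ∈ Λ, ∀ μ, μ ∉ Set.range bit → Refuted 𝔄 𝔅 d (part d μ))
    (h₂ : ∀ d ∈ Λ, ∀ y p, p ∈ part d (bit y) ↔ p ∈ Z ∧ ξ p = y)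
    (h₃ : ∀ d ∈ Λ, ∀ y, (part d (bit y)).Subsingleton) :
    ∃ lam : A → L,
      (∀ d ∈ V, ∀ d' ∈ V, ∀ π : Equiv.Perm L,
        (∀ μ, NodeEq 𝔄 𝔅 (d, part d μ) (d', part d' (π μ))) → lam d' = π (lam d)) ∧
      (∀ d ∈ V, ¬ Refuted 𝔄 𝔅 d (part d (lam d))) ∧
      (∀ d ∈ V, ∀ μ, NodeEq 𝔄 𝔅 (u, D) (d, part d μ) → lam d = μ) ∧
      ∀ d ∈ Λ, lam d = bit (x d) := by
  classical
  let s : Setoid A := ⟨PartLinked 𝔄 𝔅 part, equivalence_partLinked 𝔄 𝔅 part⟩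
  -- Representatives lie in `Λ` whenever possible, so that their letters can be read off from `x`.
  have hrep : ∀ c : Quotient s, ∃ b, Quotient.mk s b = c ∧
      ((∃ d ∈ Λ, Quotient.mk s d = c) → b ∈ Λ) ∧ ((∃ d ∈ V, Quotient.mk s d = c) → b ∈ V) := by
    intro c
    by_cases hcΛ : ∃ d ∈ Λ, Quotient.mk s d = c
    · obtain ⟨d, hd, rfl⟩ := hcΛ
      exact ⟨d, rfl, fun _ => hd, fun _ => hΛ hd⟩
    by_cases hcV : ∃ d ∈ V, Quotient.mk s d = c
    · obtain ⟨d, hd, rfl⟩ := hcV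
      exact ⟨d, rfl, fun h => absurd h hcΛ, fun _ => hd⟩
    · exact ⟨c.out, c.out_eq, fun h => absurd h hcΛ, fun h => absurd h hcV⟩
  choose rep hrep hrepΛ hrepV using hrep
  have hlet : ∀ b, ∃ μ, (b ∈ V → Alive 𝔄 𝔅 D part u b μ) ∧ (b ∈ Λ → μ = bit (x b)) := by
    intro b
    by_cases hbΛ : b ∈ Λ
    · exact ⟨_, fun hb => alive_of_solution (hdisj b) (hB b hb) (hpart b) hx (h₁ b hbΛ)
        (h₂ b hbΛ) (h₃ b hbΛ), fun _ => rfl⟩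
    by_cases hb : b ∈ V
    · obtain ⟨μ, hμ⟩ := exists_alive (hdisj b) (hB b hb) (hpart b) hx
      exact ⟨μ, fun _ => hμ, fun h => absurd h hbΛ⟩
    -- Outside `V` the letter does not matter; `bit 0` is a dummy.
    · exact ⟨bit 0, fun h => absurd h hb, fun h => absurd h hbΛ⟩
  choose μ₀ hμ₀ hμΛ using hlet
  have hperm : ∀ d, PartLinked 𝔄 𝔅 part (rep (Quotient.mk s d)) d := fun d =>
    Quotient.exact (hrep (Quotient.mk s d))
  choose π₀ hπ₀ using hperm
  have halive : ∀ d ∈ V, Alive 𝔄 𝔅 D part u (rep (Quotient.mk s d)) (μ₀ (rep (Quotient.mk s d))) :=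
    fun d hd => hμ₀ _ (hrepV _ ⟨d, hd, rfl⟩)
  have hnref : ∀ d ∈ V, ¬ Refuted 𝔄 𝔅 d (part d (π₀ d (μ₀ (rep (Quotient.mk s d))))) :=
    fun d hd h => (halive d hd).1 ((hπ₀ d _).refuted h)
  refine ⟨fun d => π₀ d (μ₀ (rep (Quotient.mk s d))), ?_, hnref, ?_, ?_⟩
  · intro d hd d' hd' π hπ
    have hq : Quotient.mk s d = Quotient.mk s d' := Quotient.sound ⟨π, hπ⟩
    -- Pulling `π` of the letter of `d` back along the fixed link to `d'` gives a letter linked to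
    -- the chosen one at the representative. Aliveness makes the two equal.
    have key := hπ₀ d' ((π₀ d').symm (π (π₀ d (μ₀ (rep (Quotient.mk s d))))))
    rw [Equiv.apply_symm_apply, ← hq] at key
    have := (halive d hd).2.1 _ (((hπ₀ d _).trans (hπ _)).trans key.symm)
    rw [Equiv.symm_apply_eq] at this
    rw [this, hq]
  · intro d hd μ hμ
    have key := hπ₀ d ((π₀ d).symm μ)
    rw [Equiv.apply_symm_apply] at key
    have := (halive d hd).2.2 _ (hμ.trans key.symm)
    rw [Equiv.symm_apply_eq] at this
    exact this.symm
  · intro d hd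
    have hb : rep (Quotient.mk s d) ∈ Λ := hrepΛ _ ⟨d, hd, rfl⟩
    have hlink := hπ₀ d (μ₀ (rep (Quotient.mk s d)))
    have hnr := hnref d (hΛ hd)
    change π₀ d (μ₀ (rep (Quotient.mk s d))) = _
    generalize rep (Quotient.mk s d) = b at hb hlink hnr ⊢
    rw [hμΛ b hb] at hlink hnr ⊢
    obtain ⟨y, hy⟩ : π₀ d (bit (x b)) ∈ Set.range bit := by
      by_contra h
      exact hnr (h₁ d hd _ h)
    rw [← hy] at hlink ⊢
    -- Excluding all letters that are not bits, at both `b` and `d`, describes membership in `Z`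
    -- exactly.
    have hc : ∀ (M : Finset L), (∀ ν ∈ M, ν ∉ Set.range bit) →
        Concluded 𝔄 𝔅 D Z ξ u b d fun p p' => (p ∈ B b ∧ p' ∈ B d) ∧
          ∀ ν ∈ M, p ∉ part b ν ∧ p' ∉ part d ν := by
      intro M hM
      induction M using Finset.induction_on with
      | empty =>
        exact ((concluded_true.param_left (hB b (hΛ hb))).param_right (hB d (hΛ hd))).congr
          fun p p' => by simp
      | insert ν M _ ih =>
        have hν := hM ν (Finset.mem_insert_self _ _)
        refine (((ih fun ν hν => hM ν (Finset.mem_insert_of_mem hν)).refuted_left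
          (h₁ b hb ν hν)).refuted_right (h₁ d hd ν hν)).congr fun p p' => ?_
        rw [Finset.forall_mem_insert]
        tauto
    have := Fintype.ofFinite L
    have hZ : ∀ d ∈ Λ, ∀ p, p ∈ Z ↔ p ∈ B d ∧ ∀ ν, ν ∉ Set.range bit → p ∉ part d ν := by
      intro d hd p
      constructor
      · intro hp
        have hp' := (h₂ d hd _ p).2 ⟨hp, rfl⟩
        exact ⟨hsub _ _ hp', fun ν hν h => hν ⟨_, hdisj _ _ _ p hp' h⟩⟩
      · rintro ⟨hp, h⟩
        obtain ⟨μ, hμ⟩ := hpart d p hp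
        by_cases hr : μ ∈ Set.range bit
        · obtain ⟨z, rfl⟩ := hr
          exact ((h₂ d hd z p).1 hμ).1
        · exact absurd hμ (h μ hr)
    -- Over two elements, the link between `bit (x b)` at `b` and `bit y` at `d` is the equation `ξ
    -- p + ξ p' = x b + y`. As `x` satisfies it, `y = x d`.
    have key := hx.add_eq (b := b) (b' := d) (β := x b + y) <|
      ((hc {ν | ν ∉ Set.range bit} (by simp)).link hlink).congr fun p p' => by
        have e : ∀ a b c d : ZMod 2, a + b = c + d ↔ (a = c ↔ b = d) := by decide
        rw [h₂ b hb, h₂ d hd, hZ b hb p, hZ d hd p', e]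
        simp only [Finset.mem_filter_univ]
        constructor
        · rintro ⟨⟨h1, h2⟩, ⟨h3, h4⟩, h5⟩
          exact ⟨⟨⟨h1, h3⟩, fun ν hν => ⟨h2 ν hν, h4 ν hν⟩⟩, by tauto⟩
        · rintro ⟨⟨⟨h1, h3⟩, h⟩, h5⟩
          have h2 := fun ν hν => (h ν hν).1
          have h4 := fun ν hν => (h ν hν).2
          exact ⟨⟨h1, h2⟩, ⟨h3, h4⟩, by tauto⟩
    rw [add_left_cancel key]

end Letters

/-! ### Classes of block statements and their partial solutions -/

section Classes

variable {n k : ℕ} {A : Type}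

/-- Basic equivalences between statements `a ∈ block f` that follow from the constraints. -/
inductive BlockStep (𝔄₀ : (relLang (TauSym n k)).Structure A) : A × ℕ → A × ℕ → Prop
  | level {l : ℕ} (ρ : TauSym n k l) (t : Fin l → A) (ht : 𝔄₀.RelMap ρ t) (i j : Fin l) {f : ℕ}
      (hf : f ≤ ρ.coreDepth) : BlockStep 𝔄₀ (t i, f) (t j, f)
  | transfer {l : ℕ} (ρ : TauSym n k l) (t : Fin l → A) (ht : 𝔄₀.RelMap ρ t) {i j : Fin l}
      (h : ρ.IsTransfer i j) {f : ℕ} (hf : ρ.coreDepth ≤ f) :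
      BlockStep 𝔄₀ (t i, f + 1) (t j, f)
  | top (a : A) {f : ℕ} (hf : k ≤ f) : BlockStep 𝔄₀ (a, f) (a, f + 1)

/-- The equivalence generated by `BlockStep`. -/
def BlockEq (𝔄₀ : (relLang (TauSym n k)).Structure A) : A × ℕ → A × ℕ → Prop :=
  Relation.EqvGen (BlockStep 𝔄₀)

variable {𝔄₀ : (relLang (TauSym n k)).Structure A}

namespace BlockEq

theorem refl (x : A × ℕ) : BlockEq 𝔄₀ x x := Relation.EqvGen.refl _

theorem symm {x y : A × ℕ} (h : BlockEq 𝔄₀ x y) : BlockEq 𝔄₀ y x :=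
  Relation.EqvGen.symm _ _ h

theorem trans {x y z : A × ℕ} (h : BlockEq 𝔄₀ x y) (h' : BlockEq 𝔄₀ y z) : BlockEq 𝔄₀ x z :=
  Relation.EqvGen.trans _ _ _ h h'

theorem level {l : ℕ} {ρ : TauSym n k l} {t : Fin l → A} (ht : 𝔄₀.RelMap ρ t) (i j : Fin l)
    {f : ℕ} (hf : f ≤ ρ.coreDepth) : BlockEq 𝔄₀ (t i, f) (t j, f) :=
  Relation.EqvGen.rel _ _ (.level ρ t ht i j hf)

theorem transfer {l : ℕ} {ρ : TauSym n k l} {t : Fin l → A} (ht : 𝔄₀.RelMap ρ t) {i j : Fin l}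
    (h : ρ.IsTransfer i j) {f : ℕ} (hf : ρ.coreDepth ≤ f) : BlockEq 𝔄₀ (t i, f + 1) (t j, f) :=
  Relation.EqvGen.rel _ _ (.transfer ρ t ht h hf)

theorem top (a : A) {f : ℕ} (hf : k ≤ f) : BlockEq 𝔄₀ (a, k) (a, f) := by
  induction f, hf using Nat.le_induction with
  | base => exact refl _
  | succ f hf ih => exact ih.trans (Relation.EqvGen.rel _ _ (.top a hf))

/-- Each basic step carries initial segments to initial segments. For a transfer, levels up to the
core go by `level`, and larger ones by the shift. -/
theorem pull {x y : A × ℕ} (h : BlockEq 𝔄₀ x y) :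
    (∀ i ≤ x.2, ∃ i' ≤ y.2, BlockEq 𝔄₀ (x.1, i) (y.1, i')) ∧
      ∀ i ≤ y.2, ∃ i' ≤ x.2, BlockEq 𝔄₀ (y.1, i) (x.1, i') := by
  induction h with
  | rel x y h =>
    cases h with
    | level ρ t ht i j hf =>
      exact ⟨fun m hm => ⟨m, hm, level ht i j (hm.trans hf)⟩,
        fun m hm => ⟨m, hm, level ht j i (hm.trans hf)⟩⟩
    | @transfer l ρ t ht i j h f hf =>
      refine ⟨fun m hm => ?_, fun m hm => ?_⟩
      · by_cases hm' : m ≤ ρ.coreDepth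
        · exact ⟨m, hm'.trans hf, level ht i j hm'⟩
        · obtain ⟨m, rfl⟩ : ∃ m', m = m' + 1 := ⟨m - 1, by omega⟩
          exact ⟨m, Nat.le_of_succ_le_succ hm, transfer ht h (by omega)⟩
      · by_cases hm' : ρ.coreDepth ≤ m
        · exact ⟨m + 1, Nat.succ_le_succ hm, (transfer ht h hm').symm⟩
        · exact ⟨m, Nat.le_succ_of_le hm, level ht j i (by omega)⟩
    | @top a f hf =>
      refine ⟨fun m hm => ⟨m, Nat.le_succ_of_le hm, refl _⟩, fun m hm => ?_⟩
      rcases Nat.le_succ_iff.1 hm with hm | rfl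
      · exact ⟨m, hm, refl _⟩
      · exact ⟨f, le_rfl, Relation.EqvGen.symm _ _ (.rel _ _ (.top a hf))⟩
  | refl x => exact ⟨fun m hm => ⟨m, hm, refl _⟩, fun m hm => ⟨m, hm, refl _⟩⟩
  | symm x y _ ih => exact ih.symm
  | trans x y z _ _ ih ih' =>
    constructor
    · intro m hm
      obtain ⟨m', hm', h⟩ := ih.1 m hm
      obtain ⟨m'', hm'', h'⟩ := ih'.1 m' hm'
      exact ⟨m'', hm'', h.trans h'⟩
    · intro m hm
      obtain ⟨m', hm', h⟩ := ih'.2 m hm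
      obtain ⟨m'', hm'', h'⟩ := ih.2 m' hm'
      exact ⟨m'', hm'', h.trans h'⟩

/-- Let `m` be the least level of `d` in the class. A level `i` between `m` and `f''` pulls back to
some `i' ≤ m`; pulling `m` along this equivalence lands at a level of the class that is at most
`i'`. Minimality gives `i' = m`. -/
theorem convex {d : A} {f f' f'' : ℕ} (h : BlockEq 𝔄₀ (d, f) (d, f'')) (hf : f ≤ f')
    (hf' : f' ≤ f'') : BlockEq 𝔄₀ (d, f) (d, f') := by
  classical
  have hex : ∃ m, BlockEq 𝔄₀ (d, f'') (d, m) := ⟨f'', refl _⟩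
  set m := Nat.find hex with hm
  have hspec : BlockEq 𝔄₀ (d, f'') (d, m) := Nat.find_spec hex
  have hmin : ∀ m', BlockEq 𝔄₀ (d, f'') (d, m') → m ≤ m' := fun m' h => Nat.find_min' hex h
  have key : ∀ i, m ≤ i → i ≤ f'' → BlockEq 𝔄₀ (d, i) (d, m) := by
    intro i hi hi'
    obtain ⟨i', hi'm, h1⟩ := hspec.pull.1 i hi'
    obtain ⟨i'', hi''i', h2⟩ := h1.pull.1 m hi
    have h3 : m ≤ i'' := hmin _ (hspec.trans h2)
    obtain rfl : i' = m := le_antisymm hi'm (h3.trans hi''i')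
    exact h1
  have hmf : m ≤ f := hmin _ h.symm
  exact (key f hmf (hf.trans hf')).trans (key f' (hmf.trans hf) hf').symm

end BlockEq

/-- The equivalence class of a statement. -/
def blockClass (𝔄₀ : (relLang (TauSym n k)).Structure A) (x : A × ℕ) : A × ℕ → Prop :=
  fun y => BlockEq 𝔄₀ x y

theorem blockClass_eq {x y : A × ℕ} (h : BlockEq 𝔄₀ x y) :
    blockClass 𝔄₀ x = blockClass 𝔄₀ y :=
  funext fun _ => propext ⟨fun h' => h.symm.trans h', fun h' => h.trans h'⟩

/-- If the statements in `K` hold, then the constraint must be satisfied by a solution for `K`. -/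
def Active (K : A × ℕ → Prop) {l : ℕ} (ρ : TauSym n k l) (t : Fin l → A) : Prop :=
  (∃ i f, f ≤ ρ.coreDepth ∧ K (t i, f)) ∨ ∃ i j m f, ρ.IsTransfer i j ∧ K (t m, f)

/-- `h` satisfies the statements in `K` and all active constraints. -/
def IsSolution (𝔄₀ : (relLang (TauSym n k)).Structure A) (K : A × ℕ → Prop)
    (h : A → Leaf n k) : Prop :=
  (∀ d f, K (d, f) → h d ∈ Leaf.block f) ∧
    ∀ l (ρ : TauSym n k l) (t : Fin l → A), 𝔄₀.RelMap ρ t → Active K ρ t → ρ.Rel (h ∘ t)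

/-- A structure and a template that extend those for `𝔓^{n,k}`. -/
structure TauEmbedding {E : ℕ → Type} (𝔄₀ : (relLang (TauSym n k)).Structure A)
    (𝔄 : (relLang E).Structure A) (𝔅 : (relLang E).Structure (Leaf n k)) where
  sym : ∀ {l}, TauSym n k l → E l
  rel_src : ∀ {l} (ρ : TauSym n k l) t, 𝔄₀.RelMap ρ t → 𝔄.RelMap (sym ρ) t
  rel_tgt : ∀ {l} (ρ : TauSym n k l) q, 𝔅.RelMap (sym ρ) q → ρ.Rel q

variable {E : ℕ → Type} {𝔄 : (relLang E).Structure A} {𝔅 : (relLang E).Structure (Leaf n k)}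

theorem TauSym.IsTransfer.block_iff {l : ℕ} {ρ : TauSym n k l} {i j : Fin l}
    (h : ρ.IsTransfer i j) {f : ℕ} (hf : ρ.coreDepth ≤ f) {q : Fin l → Leaf n k}
    (hq : ρ.Rel q) : q i ∈ Leaf.block (f + 1) ↔ q j ∈ Leaf.block f :=
  ⟨fun hi => ((h.2.2 f hf _ q hq).1 ⟨hi, rfl⟩).1, fun hj => ((h.2.2 f hf _ q hq).2 ⟨hj, rfl⟩).1⟩

namespace TauEmbedding

theorem nodeEq (ι : TauEmbedding 𝔄₀ 𝔄 𝔅) {l : ℕ} {ρ : TauSym n k l} {t : Fin l → A} (ht : 𝔄₀.RelMap ρ t) {i j : Fin l}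
    {W W' : Set (Leaf n k)} (h : ∀ q, ρ.Rel q → (q i ∈ W ↔ q j ∈ W')) :
    NodeEq 𝔄 𝔅 (t i, W) (t j, W') :=
  NodeEq.of_rel ρ.arity_le (ι.rel_src ρ t ht) fun q hq => h q (ι.rel_tgt ρ q hq)

theorem exists_rel (ι : TauEmbedding 𝔄₀ 𝔄 𝔅) {l : ℕ} {ρ : TauSym n k l} {t : Fin l → A} (ht : 𝔄₀.RelMap ρ t) {i : Fin l}
    {W : Set (Leaf n k)} (h : ¬ Refuted 𝔄 𝔅 (t i) W) : ∃ q, ρ.Rel q ∧ q i ∈ W := by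
  by_contra! hcon
  exact h (Refuted.of_rel ρ.arity_le (ι.rel_src ρ t ht) fun q hq => hcon q (ι.rel_tgt ρ q hq))

theorem nodeEq_block (ι : TauEmbedding 𝔄₀ 𝔄 𝔅) {x y : A × ℕ} (h : BlockEq 𝔄₀ x y) :
    NodeEq 𝔄 𝔅 (x.1, Leaf.block x.2) (y.1, Leaf.block y.2) := by
  induction h with
  | rel x y h =>
    cases h with
    | level ρ t ht i j hf =>
      exact ι.nodeEq ht fun q hq => ⟨fun h => ρ.rel_block hf hq h j, fun h => ρ.rel_block hf hq h i⟩
    | transfer ρ t ht h hf => exact ι.nodeEq ht fun q hq => h.block_iff hf hq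
    | top a hf => rw [Leaf.block_succ_of_le hf]; exact NodeEq.refl _
  | refl x => exact NodeEq.refl _
  | symm x y _ ih => exact ih.symm
  | trans x y z _ _ ih ih' => exact ih.trans ih'

theorem rel_of_mem_block_last (ι : TauEmbedding 𝔄₀ 𝔄 𝔅) {h : A → Leaf n k} {l : ℕ} {ρ : TauSym n k l} {t : Fin l → A}
    (ht : 𝔄₀.RelMap ρ t) (hρ : ρ.coreDepth = k) {i : Fin l}
    (hr : ¬ Refuted 𝔄 𝔅 (t i) (Leaf.block k)) (hh : ∀ j, h (t j) ∈ Leaf.block k) :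
    ρ.Rel (h ∘ t) := by
  obtain ⟨q, hq, hqi⟩ := ι.exists_rel ht hr
  have : h ∘ t = q :=
    funext fun j => Leaf.eq_of_mem_block (hh j) (ρ.rel_block hρ.ge hq hqi j)
  rwa [this]

/-- The constant map `0^k` works: an unrefuted constraint of full core depth contains the tuple of
leaves `0^k`. Transfers cannot be active, since they would lower the rank. -/
theorem refuted_or_exists_isSolution_last (ι : TauEmbedding 𝔄₀ 𝔄 𝔅) {u : A}
    (hmin : ∀ d f, BlockEq 𝔄₀ (u, k) (d, f) → k ≤ f) :
    Refuted 𝔄 𝔅 u (Leaf.block k) ∨ ∃ h, IsSolution 𝔄₀ (blockClass 𝔄₀ (u, k)) h := by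
  refine or_iff_not_imp_left.2 fun hu => ?_
  obtain ⟨v, hv⟩ := Leaf.exists_mem_block (n := n) k k
  refine ⟨fun _ => v, fun d f _ i _ => ?_, fun l ρ t ht hact => ?_⟩
  · by_cases hi : i < k
    · exact hv i hi
    · exact Leaf.entry_eq_none_of_le v (by omega)
  · rcases hact with ⟨i, f, hf, hi⟩ | ⟨i, j, m, f, htr, hm⟩
    · have hkf := hmin _ _ hi
      have hρ := ρ.coreDepth_le
      obtain rfl : f = k := by omega
      exact ι.rel_of_mem_block_last (h := fun _ => v) ht (le_antisymm hρ hf) (i := i)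
        (fun h => hu ((ι.nodeEq_block hi).refuted h)) fun _ => hv
    · exfalso
      have key : ∀ f, ¬ BlockEq 𝔄₀ (u, k) (t i, f) := by
        intro f hf
        have h1 := hf.trans (BlockEq.top (t i) (hmin _ _ hf)).symm
        have hlt := htr.2.1
        have h2 := BlockEq.transfer ht htr (f := k - 1) (by omega)
        rw [Nat.sub_add_cancel (by omega)] at h2
        have := hmin _ _ (h1.trans h2)
        omega
      rcases htr.1 m with rfl | rfl
      · exact key f hm
      · have := hmin _ _ hm
        exact key (f + 1) (BlockEq.trans hm (BlockEq.transfer ht htr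
          (ρ.coreDepth_le.trans this)).symm)

end TauEmbedding

/-- Solutions for all classes of statements `a ∈ block 0` yield a homomorphism. -/
theorem inCsp_of_isSolution
    (h : ∀ u, ∃ h, IsSolution 𝔄₀ (blockClass 𝔄₀ (u, 0)) h) : InCsp (structP n k) 𝔄₀ := by
  classical
  have hS : ∀ K : A × ℕ → Prop, ∃ s : A → Leaf n k, (∃ h, IsSolution 𝔄₀ K h) →
      IsSolution 𝔄₀ K s := by
    intro K
    by_cases hK : ∃ h, IsSolution 𝔄₀ K h
    · exact ⟨hK.choose, fun _ => hK.choose_spec⟩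
    · exact ⟨fun _ => (Leaf.exists_mem_block k 0).choose, fun h => absurd h hK⟩
  choose S hS using hS
  -- The solution is chosen per class, not per element. The entries of a constraint share their
  -- class at level `0`, so they all use the same solution.
  refine (inCsp_iff _ _).2 ⟨fun a => S (blockClass 𝔄₀ (a, 0)) a, fun l ρ t ht => ?_⟩
  have i : Fin l := ⟨0, TauSym.arity_pos ρ⟩
  have := (hS _ (h (t i))).2 l ρ t ht (.inl ⟨i, 0, Nat.zero_le _, BlockEq.refl _⟩)
  have e : (fun a => S (blockClass 𝔄₀ (a, 0)) a) ∘ t = S (blockClass 𝔄₀ (t i, 0)) ∘ t :=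
    funext fun j => congrFun (congrArg S
      (blockClass_eq (BlockEq.level ht j i (Nat.zero_le _)))) (t j)
  change TauSym.Rel ρ _
  rwa [e]

end Classes

/-! ### Solving a class from the classes of larger rank -/

section Main

variable {n k : ℕ}

/-- The leaves that consist of `k - 1` zeros and the encoding of an element of the two-element
field. -/
def bitLeaves (c₁ : Outer n) (k : ℕ) : Set (Leaf n k) :=
  {p | ∃ y, p ∈ Leaf.part (k - 1) (bitLetter c₁ y)}

open Classical in
/-- The element of the two-element field encoded by a leaf. -/
noncomputable def leafBit (p : Leaf n k) : ZMod 2 := if p ∈ Leaf.part (k - 1) none then 0 else 1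

theorem mem_part_bitLetter_iff (c₁ : Outer n) (y : ZMod 2) (p : Leaf n k) :
    p ∈ Leaf.part (k - 1) (bitLetter c₁ y) ↔ p ∈ bitLeaves c₁ k ∧ leafBit p = y := by
  have key : ∀ z : ZMod 2, p ∈ Leaf.part (k - 1) (bitLetter c₁ z) → leafBit p = z := by
    intro z hz
    have h2 : ∀ z : ZMod 2, z = 0 ∨ z = 1 := by decide
    rcases h2 z with rfl | rfl
    · exact if_pos hz
    · refine if_neg fun h => ?_
      have := h.2.symm.trans hz.2
      simp [bitLetter] at this
  constructor
  · exact fun h => ⟨⟨y, h⟩, key y h⟩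
  · rintro ⟨⟨z, hz⟩, rfl⟩
    rwa [key z hz]

variable {A : Type} {E : ℕ → Type} {𝔄₀ : (relLang (TauSym n k)).Structure A}
  {𝔄 : (relLang E).Structure A} {𝔅 : (relLang E).Structure (Leaf n k)}

/-- The classes of larger rank than `r` are refuted or have solutions. -/
def SolvedAbove (𝔄₀ : (relLang (TauSym n k)).Structure A) (𝔄 : (relLang E).Structure A)
    (𝔅 : (relLang E).Structure (Leaf n k)) (r : ℕ) : Prop :=
  ∀ d f, r < f → f ≤ k → (∀ d' f', BlockEq 𝔄₀ (d, f) (d', f') → f ≤ f') →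
    Refuted 𝔄 𝔅 d (Leaf.block f) ∨ ∃ h, IsSolution 𝔄₀ (blockClass 𝔄₀ (d, f)) h

/-- An element `d` gets `g d` zeros, then the letter `lam d`; after the letter `0` it follows the
solution of the class of `(d, g d + 1)`. A constraint either relates equal frames above its core by
permutations, shifts frames by one as a transfer, or has all its entries reach the core, where
`core_cases` applies. -/
theorem exists_isSolution (ι : TauEmbedding 𝔄₀ 𝔄 𝔅) (c₁ : Outer n) (hc : (c₁.1 : ℕ) = 1)
    {u : A} {r : ℕ} (hr : r < k) (hmin : ∀ d f, BlockEq 𝔄₀ (u, r) (d, f) → r ≤ f)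
    (hsolved : SolvedAbove 𝔄₀ 𝔄 𝔅 r) {x : A → ZMod 2}
    (hx : IsSystemSolution 𝔄 𝔅 (Leaf.block r) (bitLeaves c₁ k) leafBit u x) :
    ∃ h, IsSolution 𝔄₀ (blockClass 𝔄₀ (u, r)) h := by
  classical
  set K := blockClass 𝔄₀ (u, r) with hK
  have hKeq : ∀ {y z}, K y → BlockEq 𝔄₀ y z → K z := fun hy h => BlockEq.trans hy h
  have hKD : ∀ {d f}, K (d, f) → NodeEq 𝔄 𝔅 (u, Leaf.block r) (d, Leaf.block f) :=
    fun h => ι.nodeEq_block h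
  have hKref : ∀ {d f}, K (d, f) → ¬ Refuted 𝔄 𝔅 d (Leaf.block f) := by
    intro d f hd href
    refine hx.not_false (((concluded_true (b := d) (b' := d)).param_left
      (hKD hd)).refuted_left href |>.congr fun p p' => ?_)
    tauto
  -- maximal frames
  set g : A → ℕ := fun d => Nat.findGreatest (fun f => K (d, f)) k with hg
  have hgk : ∀ d, g d ≤ k := fun d => Nat.findGreatest_le _
  have hle : ∀ {d f}, K (d, f) → f ≤ k → f ≤ g d := fun h hf => Nat.le_findGreatest hf h
  have htop : ∀ {d f}, K (d, f) → k ≤ f → K (d, k) :=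
    fun h hf => hKeq h (BlockEq.top _ hf).symm
  have hgK : ∀ {d f}, K (d, f) → K (d, g d) := by
    intro d f h
    by_cases hf : f ≤ k
    · exact Nat.findGreatest_spec (P := fun f => K (d, f)) hf h
    · exact Nat.findGreatest_spec (P := fun f => K (d, f)) le_rfl (htop h (by omega))
  have hconv : ∀ {d f f'}, K (d, f) → f ≤ f' → f' ≤ g d → K (d, f') :=
    fun h hf hf' => hKeq h (BlockEq.convex (h.symm.trans (hgK h)) hf hf')
  have hnot : ∀ {d}, g d < k → ¬ K (d, g d + 1) := fun hd h => by
    have := hle h hd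
    omega
  -- letters
  set G : A → ℕ := fun d => min (g d) (k - 1) with hG
  set V : Set A := {d | K (d, G d)} with hV
  -- The elements whose last letter is forced to be a bit; their letters must come from `x`.
  set Λ : Set A := {d | d ∈ V ∧ G d = k - 1 ∧ ∀ μ, μ ∉ Set.range (bitLetter c₁) →
    Refuted 𝔄 𝔅 d (Leaf.part (k - 1) μ)} with hΛ
  obtain ⟨lam, hlam₁, hlam₂, hlam₃, hlam₄⟩ := exists_letters (V := V) (Λ := Λ)
    (part := fun d μ => Leaf.part (G d) μ) (B := fun d => Leaf.block (G d)) (bit := bitLetter c₁)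
    (fun d μ ν p h h' => h.2.symm.trans h'.2) (fun d μ => Leaf.part_subset_block μ)
    (fun d p hp => ⟨_, hp, rfl⟩) (fun d hd => hKD hd) hx (fun d hd => hd.1)
    (fun d hd μ hμ => by rw [hd.2.1]; exact hd.2.2 μ hμ)
    (fun d hd y p => by rw [hd.2.1]; exact mem_part_bitLetter_iff c₁ y p)
    (fun d hd y p hp q hq => by
      rw [hd.2.1] at hp hq
      exact Leaf.eq_of_mem_part_last (by omega) hp hq)
  have hGg : ∀ {d}, g d < k → G d = g d := fun hd => by simp only [hG]; omega
  have hmemV : ∀ {d f}, K (d, f) → g d < k → d ∈ V := fun h hd => by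
    change K (_, G _)
    rw [hGg hd]
    exact hgK h
  -- solutions for the classes of larger rank
  have hchild : ∀ d, d ∈ V → g d < k → lam d = none →
      ∃ h, IsSolution 𝔄₀ (blockClass 𝔄₀ (d, g d + 1)) h := by
    intro d hd hgd hl
    have hdK : K (d, g d) := hgK hd
    have hex : ∃ f c, BlockEq 𝔄₀ (d, g d + 1) (c, f) := ⟨_, _, BlockEq.refl _⟩
    obtain ⟨c, hcf⟩ := Nat.find_spec hex
    have hmin' : ∀ c' f', BlockEq 𝔄₀ (d, g d + 1) (c', f') → Nat.find hex ≤ f' :=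
      fun c' f' h => Nat.find_min' hex ⟨c', h⟩
    generalize Nat.find hex = f at hcf hmin'
    -- If the rank did not grow, pulling `(d, g d)` down to `c` would land at `(c, f)`, so `(d, g d
    -- + 1)` would lie in `K`, against the maximality of `g d`.
    have hrf : r < f := by
      by_contra! hfr
      obtain ⟨m, hm, hdm⟩ := hcf.pull.1 (g d) (Nat.le_succ _)
      have h1 := hmin _ _ (BlockEq.trans hdK hdm)
      obtain rfl : m = f := by simp only at hm; omega
      exact hnot hgd (hKeq hdK (hdm.trans hcf.symm))
    rcases hsolved c f hrf ((hmin' _ _ (BlockEq.refl _)).trans hgd)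
      (fun d' f' h => hmin' _ _ (hcf.trans h)) with href | hsol
    · refine absurd ((ι.nodeEq_block hcf).refuted href) ?_
      have := hlam₂ d hd
      rwa [hl, hGg hgd, Leaf.part_none] at this
    · rwa [blockClass_eq hcf]
  have hS : ∀ K : A × ℕ → Prop, ∃ s : A → Leaf n k, (∃ h, IsSolution 𝔄₀ K h) →
      IsSolution 𝔄₀ K s := by
    intro K
    by_cases hK : ∃ h, IsSolution 𝔄₀ K h
    · exact ⟨hK.choose, fun _ => hK.choose_spec⟩
    · exact ⟨fun _ => (Leaf.exists_mem_block k 0).choose, fun h => absurd h hK⟩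
  choose S hS using hS
  -- the solution
  have hval : ∀ d, ∃ v : Leaf n k, (K (d, k) → v ∈ Leaf.block k) ∧
      (¬ K (d, k) → g d < k → (∀ c, lam d = some c → v ∈ Leaf.part (g d) (some c)) ∧
        (lam d = none → v = S (blockClass 𝔄₀ (d, g d + 1)) d)) := by
    intro d
    by_cases hd : K (d, k)
    · obtain ⟨v, hv⟩ := Leaf.exists_mem_block (n := n) k k
      exact ⟨v, fun _ => hv, fun h => absurd hd h⟩
    by_cases hgd : g d < k
    · cases hl : lam d with
      | none => exact ⟨_, fun h => absurd h hd, fun _ _ => ⟨fun c h => by simp at h, fun _ => rfl⟩⟩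
      | some c =>
        obtain ⟨v, hv⟩ := Leaf.exists_mem_part hgd (some c)
        exact ⟨v, fun h => absurd h hd, fun _ _ => ⟨fun c' h => h ▸ hv, fun h => by simp at h⟩⟩
    · obtain ⟨v, hv⟩ := Leaf.exists_mem_block (n := n) k k
      exact ⟨v, fun _ => hv, fun _ h => absurd h hgd⟩
  choose h hhk hh using hval
  have hglt : ∀ {d f}, K (d, f) → ¬ K (d, k) → g d < k := by
    intro d f hd hdk
    refine lt_of_le_of_ne (hgk d) fun e => hdk ?_
    have := hgK hd
    rwa [e] at this
  have hgeq : ∀ {d}, K (d, k) → g d = k := fun hd => le_antisymm (hgk _) (hle hd le_rfl)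
  have hSd : ∀ {d f}, K (d, f) → g d < k → lam d = none →
      IsSolution 𝔄₀ (blockClass 𝔄₀ (d, g d + 1)) (S (blockClass 𝔄₀ (d, g d + 1))) :=
    fun hd hgd hl => hS _ (hchild _ (hmemV hd hgd) hgd hl)
  have hpart : ∀ d ∈ V, h d ∈ Leaf.part (G d) (lam d) := by
    intro d hd
    by_cases hdk : K (d, k)
    · have e : G d = k - 1 := by simp only [hG, hgeq hdk]; omega
      have e' : k - 1 + 1 = k := by omega
      have hl : lam d = none := hlam₃ d hd none (by
        simp only [e, Leaf.part_none, e']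
        exact hKD hdk)
      rw [hl, Leaf.part_none, e, e']
      exact hhk d hdk
    · have hgd := hglt hd hdk
      rw [hGg hgd]
      cases hl : lam d with
      | none =>
        rw [Leaf.part_none, ((hh d hdk hgd).2 hl)]
        exact (hSd hd hgd hl).1 _ _ (BlockEq.refl _)
      | some c => exact (hh d hdk hgd).1 c hl
  have hblock : ∀ {d f}, K (d, f) → h d ∈ Leaf.block (g d) := by
    intro d f hd
    by_cases hdk : K (d, k)
    · rw [hgeq hdk]
      exact hhk d hdk
    · have hgd := hglt hd hdk
      have := hpart d (hmemV hd hgd)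
      rw [hGg hgd] at this
      exact this.1
  refine ⟨h, fun d f hd => ?_, fun l ρ t ht hact => ?_⟩
  · by_cases hf : f ≤ k
    · exact Leaf.block_anti (hle hd hf) (hblock hd)
    · intro i _
      by_cases hi : i < k
      · exact hhk d (htop hd (by omega)) i hi
      · exact Leaf.entry_eq_none_of_le _ (by omega)
  have hj := ρ.coreDepth_le
  -- some element has a frame below the core
  have hleft : ∀ i f, f ≤ ρ.coreDepth → K (t i, f) → ρ.Rel (h ∘ t) ∨
      ∀ i', K (t i', f) ∧ ρ.coreDepth ≤ g (t i') := by
    intro i₀ f hf hi₀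
    have hall : ∀ i', K (t i', f) := fun i' => hKeq hi₀ (BlockEq.level ht _ _ hf)
    by_cases hlow : ∃ i, g (t i) < ρ.coreDepth
    swap
    · exact Or.inr fun i' => ⟨hall i', not_lt.1 fun h => hlow ⟨i', h⟩⟩
    left
    obtain ⟨i, hi⟩ := hlow
    have hK' : ∀ i', K (t i', g (t i)) := fun i' =>
      hKeq (hgK (hall i)) (BlockEq.level ht _ _ hi.le)
    have hgi : g (t i) < k := by omega
    -- A longer frame at `t i'` would propagate back to `t i`, as level `g (t i) + 1` is still
    -- within the core depth.
    have hge : ∀ i', g (t i') = g (t i) := by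
      intro i'
      refine le_antisymm (not_lt.1 fun hlt => ?_) (hle (hK' i') hgi.le)
      exact hnot hgi (hKeq (hconv (hK' i') (Nat.le_succ _) hlt) (BlockEq.level ht _ _ hi))
    have hgi' : ∀ i', g (t i') < k := fun i' => by rw [hge]; exact hgi
    have hnk : ∀ i', ¬ K (t i', k) := fun i' h' => by
      have := hgeq h'
      have := hgi' i'
      omega
    have hπ : ∀ i', ∃ π : Equiv.Perm (Option (Outer n)), π none = none ∧
        lam (t i') = π (lam (t i)) ∧ ∀ μ q, ρ.Rel q →
          (q i ∈ Leaf.part (g (t i)) μ ↔ q i' ∈ Leaf.part (g (t i)) (π μ)) := by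
      intro i'
      obtain ⟨π, h0, hπ⟩ := ρ.exists_perm hi i i'
      refine ⟨π, h0, hlam₁ _ (hmemV (hall i) hgi) _ (hmemV (hall i') (hgi' i')) π fun μ => ?_, hπ⟩
      rw [hGg hgi, hGg (hgi' i'), hge i']
      exact ι.nodeEq ht (hπ μ)
    cases hl : lam (t i) with
    | none =>
      have hl' : ∀ i', lam (t i') = none := fun i' => by
        obtain ⟨π, h0, h1, -⟩ := hπ i'
        rw [h1, hl, h0]
      have e : h ∘ t = S (blockClass 𝔄₀ (t i, g (t i) + 1)) ∘ t := by
        funext i'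
        have := (hh (t i') (hnk i') (hgi' i')).2 (hl' i')
        rw [Function.comp_apply, this, hge i', blockClass_eq (BlockEq.level ht i' i hi)]
        rfl
      rw [e]
      exact (hSd (hall i) hgi hl).2 _ ρ t ht (.inl ⟨i, _, hi, BlockEq.refl _⟩)
    | some c =>
      have hnr := hlam₂ _ (hmemV (hall i) hgi)
      rw [hl, hGg hgi] at hnr
      obtain ⟨q, hq, hqi⟩ := ι.exists_rel ht hnr
      have e : h ∘ t = q := by
        funext i'
        obtain ⟨π, h0, h1, h2⟩ := hπ i'
        have hqi' := (h2 _ q hq).1 hqi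
        have hhi' := hpart _ (hmemV (hall i') (hgi' i'))
        rw [hGg (hgi' i'), hge i', h1, hl] at hhi'
        have hne : π (some c) ≠ none := fun h => by
          rw [← h0] at h
          simpa using π.injective h
        obtain ⟨c', hc'⟩ := Option.ne_none_iff_exists'.1 hne
        rw [hc'] at hqi' hhi'
        exact Leaf.eq_of_mem_part_some hhi' hqi'
      rwa [e]
  by_cases htr : ∃ i j, ρ.IsTransfer i j
  · obtain ⟨i, j, htr⟩ := htr
    have hred : ρ.Rel (h ∘ t) ∨ ∃ f, ρ.coreDepth ≤ f ∧ K (t i, f + 1) ∧ K (t j, f) := by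
      have hrest : ∀ m f, K (t m, f) → ρ.Rel (h ∘ t) ∨
          ∃ f, ρ.coreDepth ≤ f ∧ K (t i, f + 1) ∧ K (t j, f) := by
        intro m f hm
        rcases le_or_gt f ρ.coreDepth with hf | hf
        · rcases hleft m f hf hm with hρ | hall
          · exact Or.inl hρ
          · have hj := hconv (hall j).1 hf (hall j).2
            exact Or.inr ⟨_, le_rfl, hKeq hj (BlockEq.transfer ht htr le_rfl).symm, hj⟩
        · rcases htr.1 m with rfl | rfl
          · obtain ⟨f, rfl⟩ : ∃ f', f = f' + 1 := ⟨f - 1, by omega⟩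
            exact Or.inr ⟨f, by omega, hm, hKeq hm (BlockEq.transfer ht htr (by omega))⟩
          · exact Or.inr ⟨f, hf.le, hKeq hm (BlockEq.transfer ht htr hf.le).symm, hm⟩
      rcases hact with ⟨m, f, -, hm⟩ | ⟨-, -, m, f, -, hm⟩ <;> exact hrest m f hm
    rcases hred with hρ | ⟨f, hf, hif, hjf⟩
    · exact hρ
    have hjk := htr.2.1
    -- At frame `k` the shift has no effect, since `block (k + 1) = block k`; both entries are
    -- `0^k`.
    by_cases hik : K (t i, k)
    · have hjk' : K (t j, k) := hKeq (hKeq hik (BlockEq.top _ (Nat.le_succ k)))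
        (BlockEq.transfer ht htr hj)
      obtain ⟨q, hq, hqi⟩ := ι.exists_rel ht (hKref hik)
      have hqj : q j ∈ Leaf.block k := by
        rw [← htr.block_iff hj hq, Leaf.block_succ_of_le le_rfl]
        exact hqi
      have e : h ∘ t = q := by
        funext m
        rcases htr.1 m with rfl | rfl
        exacts [Leaf.eq_of_mem_block (hhk _ hik) hqi, Leaf.eq_of_mem_block (hhk _ hjk') hqj]
      rwa [e]
    · have hgi := hglt hif hik
      have hfk : f + 1 < k := by
        by_contra! hcon
        exact hik (htop hif hcon)
      have hgi1 : f + 1 ≤ g (t i) := hle hif hfk.le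
      obtain ⟨f', hf'⟩ : ∃ f', g (t i) = f' + 1 := ⟨g (t i) - 1, by omega⟩
      have hi' : K (t i, f' + 1) := hf' ▸ hgK hif
      have hj' : K (t j, f') := hKeq hi' (BlockEq.transfer ht htr (by omega))
      have hgj : g (t j) = f' := by
        refine le_antisymm (not_lt.1 fun hlt => ?_) (hle hj' (by omega))
        refine hnot hgi ?_
        rw [hf']
        exact hKeq (hconv hj' (Nat.le_succ _) hlt) (BlockEq.transfer ht htr (by omega)).symm
      have hgj' : g (t j) < k := by omega
      have hjk : ¬ K (t j, k) := fun h => by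
        have := hgeq h
        omega
      have hl : lam (t j) = lam (t i) :=
        hlam₁ _ (hmemV hif hgi) _ (hmemV hj' hgj') 1 fun μ => by
          rw [hGg hgi, hGg hgj', hf', hgj]
          exact ι.nodeEq ht (htr.2.2 f' (by omega) μ)
      cases hli : lam (t i) with
      | none =>
        have e : h ∘ t = S (blockClass 𝔄₀ (t i, g (t i) + 1)) ∘ t := by
          funext m
          rcases htr.1 m with rfl | rfl
          · exact (hh _ hik hgi).2 hli
          · refine ((hh _ hjk hgj').2 (hl.trans hli)).trans ?_
            rw [hgj, hf', ← blockClass_eq (BlockEq.transfer ht htr (f := f' + 1) (by omega))]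
            rfl
        rw [e]
        -- The frame is now beyond the core, so the constraint is active for the larger class only
        -- by the second clause of `Active`.
        exact (hSd hif hgi hli).2 _ ρ t ht (.inr ⟨i, j, i, _, htr, BlockEq.refl _⟩)
      | some c =>
        have hnr := hlam₂ _ (hmemV hif hgi)
        rw [hli, hGg hgi, hf'] at hnr
        obtain ⟨q, hq, hqi⟩ := ι.exists_rel ht hnr
        have hqj := (htr.2.2 f' (by omega) _ q hq).1 hqi
        have hhi := hpart _ (hmemV hif hgi)
        have hhj := hpart _ (hmemV hj' hgj')
        rw [hli, hGg hgi, hf'] at hhi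
        rw [hl, hli, hGg hgj', hgj] at hhj
        have e : h ∘ t = q := by
          funext m
          rcases htr.1 m with rfl | rfl
          exacts [Leaf.eq_of_mem_part_some hhi hqi, Leaf.eq_of_mem_part_some hhj hqj]
        rwa [e]
  obtain ⟨i₀, f, hf, hi₀⟩ : ∃ i f, f ≤ ρ.coreDepth ∧ K (t i, f) := by
    rcases hact with hact | ⟨i, j, -, -, h, -⟩
    exacts [hact, absurd ⟨i, j, h⟩ htr]
  rcases hleft i₀ f hf hi₀ with hρ | hall
  · exact hρ
  have hcoreK : ∀ i, K (t i, ρ.coreDepth) := fun i => hconv (hall i).1 hf (hall i).2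
  have hlast : ρ.coreDepth + 1 = k → ∀ i, G (t i) = k - 1 ∧ t i ∈ V := by
    intro hk i
    have e : G (t i) = k - 1 := by
      have := (hall i).2
      simp only [hG]
      omega
    refine ⟨e, ?_⟩
    change K (_, G _)
    rw [e, ← hk, Nat.add_sub_cancel]
    exact hcoreK i
  rcases TauSym.core_cases c₁ hc ρ with hρ | hρ | hρ | ⟨hk, hρ⟩ | ⟨hk, e, he, hρ⟩
  · exact hρ _ fun i => Leaf.block_anti (hall i).2 (hblock (hall i).1)
  · have hKk : ∀ i, K (t i, k) := fun i => hρ ▸ hcoreK i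
    exact ι.rel_of_mem_block_last ht hρ (hKref (hKk i₀)) fun i => hhk _ (hKk i)
  · exact absurd hρ htr
  · have hk' : ρ.coreDepth = k - 1 := by omega
    have hnr := hlam₂ _ (hlast hk i₀).2
    rw [(hlast hk i₀).1] at hnr
    obtain ⟨q, hq, hqi⟩ := ι.exists_rel ht hnr
    have e : h ∘ t = q := by
      funext i
      obtain ⟨π, hπ⟩ := hρ i₀ i
      rw [hk'] at hπ
      have hl := hlam₁ _ (hlast hk i₀).2 _ (hlast hk i).2 π fun μ => by
        rw [(hlast hk i₀).1, (hlast hk i).1]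
        exact ι.nodeEq ht (hπ μ)
      have hhi := hpart _ (hlast hk i).2
      rw [(hlast hk i).1, hl] at hhi
      exact Leaf.eq_of_mem_part_last (by omega) hhi ((hπ _ q hq).1 hqi)
    rwa [e]
  · have hk' : ρ.coreDepth = k - 1 := by omega
    have hcore : ∀ q, ρ.Rel q → ∀ i, q i ∈ Leaf.block (k - 1) →
        ∃ y : Fin 3 → ZMod 2, y 0 + y 1 + y 2 = 1 ∧
          ∀ m, q (e m) ∈ Leaf.part (k - 1) (bitLetter c₁ (y m)) := by
      intro q hq i hi
      rw [← hk'] at hi ⊢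
      exact (hρ q).1 ⟨hq, ρ.rel_block le_rfl hq hi _⟩
    -- The linear relation admits only bits, so the constraint itself refutes every other last
    -- letter.
    have hmemΛ : ∀ i, t i ∈ Λ := by
      refine fun i => ⟨(hlast hk i).2, (hlast hk i).1, fun μ hμ => ?_⟩
      by_contra hnr
      obtain ⟨q, hq, hqi⟩ := ι.exists_rel ht hnr
      obtain ⟨y, -, hy⟩ := hcore q hq i hqi.1
      obtain ⟨m, rfl⟩ := he i
      exact hμ ⟨y m, (hy m).2.symm.trans hqi.2⟩
    have hsum := hx.add_add_eq (TauSym.arity_le ρ) (ι.rel_src ρ t ht) (W := Leaf.block (k - 1)) e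
      (by rw [← hk']; exact hKD (hcoreK _)) fun q hq => by
        constructor
        · intro hb
          obtain ⟨y, hy, hyq⟩ := hcore q (ι.rel_tgt ρ q hq) _ hb
          have h0 := (mem_part_bitLetter_iff c₁ _ _).1 (hyq 0)
          have h1 := (mem_part_bitLetter_iff c₁ _ _).1 (hyq 1)
          have h2 := (mem_part_bitLetter_iff c₁ _ _).1 (hyq 2)
          rw [h0.2, h1.2, h2.2]
          exact ⟨⟨h0.1, h1.1, h2.1⟩, hy⟩
        · rintro ⟨⟨⟨y, hy⟩, -⟩, -⟩
          exact hy.1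
    refine ((hρ (h ∘ t)).2 ⟨fun m => x (t (e m)), hsum, fun m => ?_⟩).1
    have := hpart _ (hlast hk (e m)).2
    rw [hlam₄ _ (hmemΛ _), (hlast hk (e m)).1] at this
    rwa [hk']

end Main

/-! ### Finiteness of the signatures -/

theorem finite_outerSym (n : ℕ) : Finite (Σ l, OuterSym n l) := by
  refine Finite.of_surjective
    (α := Set (Outer n) ⊕ Equiv.Perm (Outer n) ⊕ Unit)
    (Sum.elim (fun Y => ⟨1, .subset Y⟩) (Sum.elim (fun σ => ⟨2, .perm σ⟩) fun _ => ⟨3, .eqThree⟩)) ?_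
  rintro ⟨_, Y | σ | _⟩
  exacts [⟨.inl Y, rfl⟩, ⟨.inr (.inl σ), rfl⟩, ⟨.inr (.inr ()), rfl⟩]

theorem finite_tauSym (n k : ℕ) : Finite (Σ l, TauSym n k l) := by
  induction k with
  | zero =>
    refine Finite.of_surjective (α := Fin 4)
      ![⟨1, .empty⟩, ⟨1, .point⟩, ⟨2, .eqTwo⟩, ⟨3, .eqThree⟩] ?_
    rintro ⟨_, _ | _ | _ | _⟩
    exacts [⟨0, rfl⟩, ⟨1, rfl⟩, ⟨2, rfl⟩, ⟨3, rfl⟩]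
  | succ k ih =>
    have := finite_outerSym n
    -- `swap` and `lin` exist only at index `1`, hence the transport along `k = 0`.
    refine Set.finite_univ_iff.1 (Set.Finite.subset
      (s := (Set.range fun x : {x : (Σ l, TauSym n k l) × (Σ l, OuterSym n l) // x.1.1 = x.2.1} =>
          (⟨x.1.1.1, .pair x.1.1.2 (x.2 ▸ x.1.2.2)⟩ : Σ l, TauSym n (k + 1) l)) ∪
        ({⟨2, .full⟩, ⟨2, .transfer⟩} ∪
          {x | (∃ h : k = 0, x = h ▸ ⟨2, .swap⟩) ∨ ∃ h : k = 0, x = h ▸ ⟨3, .lin⟩})) ?_ ?_)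
    · refine (Set.finite_range _).union ((Set.toFinite _).union ?_)
      by_cases hk : k = 0
      · subst hk
        refine (Set.toFinite {⟨2, .swap⟩, ⟨3, .lin⟩}).subset ?_
        rintro x (⟨-, rfl⟩ | ⟨-, rfl⟩) <;> simp
      · convert Set.finite_empty
        ext x
        simp [hk]
    · rintro ⟨l, x⟩ -
      cases x with
      | pair ρ θ => exact .inl ⟨⟨(⟨l, ρ⟩, ⟨l, θ⟩), rfl⟩, rfl⟩
      | full => exact .inr (.inl (by simp))
      | transfer => exact .inr (.inl (by simp))
      | swap => exact .inr (.inr (.inl ⟨rfl, rfl⟩))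
      | lin => exact .inr (.inr (.inr ⟨rfl, rfl⟩))

instance {E : ℕ → Type} (S : Stage E) : Finite (Σ l, S.Out l) :=
  have := S.finite_idb
  finite_sigma_sum

/-! ### The program and its correctness -/

section Program

variable {n k : ℕ}

/-- The program with the stages for the parameter conditions `block r`, …, `block 0`. -/
noncomputable def blockProgram (c₁ : Outer n) : (r : ℕ) → {E : ℕ → Type} →
    [Finite (Σ l, E l)] → (relLang E).Structure (Leaf n k) → ZTwoDatalog E (r + 1)
  | 0, _, _, 𝔅 => .last (walkStage 𝔅 (Leaf.block 0) (bitLeaves c₁ k) leafBit) (.inr .goal) true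
  | r + 1, _, _, 𝔅 =>
    .cons (walkStage 𝔅 (Leaf.block (r + 1)) (bitLeaves c₁ k) leafBit)
      (blockProgram c₁ r (outTemplate 𝔅 (Leaf.block (r + 1)) (bitLeaves c₁ k) leafBit))

theorem blockProgram_symmetricLinear (c₁ : Outer n) (r : ℕ) {E : ℕ → Type}
    [Finite (Σ l, E l)] (𝔅 : (relLang E).Structure (Leaf n k)) :
    (blockProgram c₁ r 𝔅).SymmetricLinear := by
  induction r generalizing E with
  | zero => exact ⟨linearRules_stageRules _ _ _ _, symmetricRules_stageRules _ _ _ _⟩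
  | succ r ih => exact ⟨⟨linearRules_stageRules _ _ _ _, symmetricRules_stageRules _ _ _ _⟩, ih _⟩

variable {A : Type}

/-- A homomorphism survives every stage. In the last one it solves every system, and the goal symbol
stands for the empty relation. -/
theorem not_derivesGoal_of_isRelHom (c₁ : Outer n) (r : ℕ) {E : ℕ → Type} [Finite (Σ l, E l)]
    {𝔄 : (relLang E).Structure A} {𝔅 : (relLang E).Structure (Leaf n k)} {h : A → Leaf n k}
    (hh : IsRelHom 𝔄 𝔅 h) : ¬ (blockProgram c₁ r 𝔅).DerivesGoal 𝔄 := by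
  induction r generalizing E with
  | zero =>
    rintro (hd | ⟨-, u, hu⟩)
    · exact hd.idbRel_comp hh
    · exact hu (hh.systemSat (Leaf.mem_block_zero _))
  | succ r ih => exact ih (hh.output (D := Leaf.block (r + 1)) (Z := bitLeaves c₁ k) (ξ := leafBit))

/-- The EDBs are copied to the output, so links found earlier stay available. -/
theorem NodeEq.output {P : Type} [Finite P] {E : ℕ → Type} [Finite (Σ l, E l)]
    {𝔄 : (relLang E).Structure A} {𝔅 : (relLang E).Structure P} {D Z : Set P} {ξ : P → ZMod 2}
    {x y : A × Set P} (h : NodeEq 𝔄 𝔅 x y) :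
    NodeEq ((walkStage 𝔅 D Z ξ).output 𝔄) (outTemplate 𝔅 D Z ξ) x y := by
  induction h with
  | rel x y h =>
    obtain ⟨l, e, t, i, j, hl, ht, hx, hy, h⟩ := h
    exact .rel _ _ ⟨l, .inl (.inl e), t, i, j, hl, output_copy ht, hx, hy, h⟩
  | refl x => exact .refl _
  | symm x y _ ih => exact ih.symm
  | trans x y z _ _ ih ih' => exact ih.trans ih'

/-- `L^⊥` is a unary constraint that denotes the complement of `D`; this single constraint links `u
∈ D` to falsity. -/
theorem refuted_output_of_not_systemSat {P : Type} [Finite P] {E : ℕ → Type}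
    [Finite (Σ l, E l)] {𝔄 : (relLang E).Structure A} {𝔅 : (relLang E).Structure P}
    {D Z : Set P} {ξ : P → ZMod 2} {u : A}
    (h : ¬ (walkStage 𝔅 D Z ξ).SystemSat 𝔄 fun _ => u) :
    Refuted ((walkStage 𝔅 D Z ξ).output 𝔄) (outTemplate 𝔅 D Z ξ) u D :=
  Refuted.of_rel (l := 1) (e := (Sum.inr SatSym.bot : (walkStage 𝔅 D Z ξ).Out 1))
    (t := fun _ => u) (i := 0) (by omega) h fun _ hq => hq

/-- The embedding for the output of a stage. -/
def TauEmbedding.output {E : ℕ → Type} [Finite (Σ l, E l)]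
    {𝔄₀ : (relLang (TauSym n k)).Structure A} {𝔄 : (relLang E).Structure A}
    {𝔅 : (relLang E).Structure (Leaf n k)} {D Z : Set (Leaf n k)} {ξ : Leaf n k → ZMod 2}
    (ι : TauEmbedding 𝔄₀ 𝔄 𝔅) :
    TauEmbedding 𝔄₀ ((walkStage 𝔅 D Z ξ).output 𝔄) (outTemplate 𝔅 D Z ξ) where
  sym ρ := .inl (.inl (ι.sym ρ))
  rel_src ρ t h := output_copy (ι.rel_src ρ t h)
  rel_tgt ρ q h := ι.rel_tgt ρ q h

/-- Each stage settles the classes of one more rank: a satisfiable system gives a solution, an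
unsatisfiable one a refutation in the output. In rank `0` unsatisfiability would fire the final
rule. -/
theorem inCsp_of_not_derivesGoal {c₁ : Outer n} (hc : (c₁.1 : ℕ) = 1) {r : ℕ} (hr : r < k)
    {E : ℕ → Type} [Finite (Σ l, E l)] {𝔄₀ : (relLang (TauSym n k)).Structure A}
    {𝔄 : (relLang E).Structure A} {𝔅 : (relLang E).Structure (Leaf n k)}
    (ι : TauEmbedding 𝔄₀ 𝔄 𝔅) (hsolved : SolvedAbove 𝔄₀ 𝔄 𝔅 r)
    (h : ¬ (blockProgram c₁ r 𝔅).DerivesGoal 𝔄) : InCsp (structP n k) 𝔄₀ := by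
  induction r generalizing E with
  | zero =>
    refine inCsp_of_isSolution fun u => ?_
    have hu : (walkStage 𝔅 (Leaf.block 0) (bitLeaves c₁ k) leafBit).SystemSat 𝔄 fun _ => u := by
      by_contra hu
      exact h (.inr ⟨rfl, _, hu⟩)
    obtain ⟨x, hx⟩ := exists_isSystemSolution hu
    exact exists_isSolution ι c₁ hc hr (fun _ _ _ => Nat.zero_le _) hsolved hx
  | succ r ih =>
    refine ih (by omega) (ι.output (D := Leaf.block (r + 1)) (Z := bitLeaves c₁ k)
      (ξ := leafBit)) (fun d f hf hfk hmin => ?_) h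
    rcases Nat.lt_or_ge (r + 1) f with hf' | hf'
    · refine (hsolved d f hf' hfk hmin).imp_left fun hd => ?_
      exact ⟨hd.choose, hd.choose_spec.output⟩
    · obtain rfl : f = r + 1 := by omega
      by_cases hu : (walkStage 𝔅 (Leaf.block (r + 1)) (bitLeaves c₁ k) leafBit).SystemSat 𝔄
        fun _ => d
      · obtain ⟨x, hx⟩ := exists_isSystemSolution hu
        exact .inr (exists_isSolution ι c₁ hc hr hmin hsolved hx)
      · exact .inl (refuted_output_of_not_systemSat hu)

end Program

theorem mainTheorem2 (n k : ℕ) (hn : 2 ≤ n) (hk : 1 ≤ k) :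
    ∃ (m : ℕ) (P : ZTwoDatalog (TauSym n k) m),
      (m : ℤ) ≤ 2 * (k : ℤ) ^ 2 + k - 2 ∧ P.SymmetricLinear ∧ P.Solves (structP n k) := by
  have := finite_tauSym n k
  let c₁ : Outer n := ⟨⟨1, by omega⟩, one_ne_zero⟩
  -- One stage for each `block r` with `r < k`; rank `k` needs none.
  refine ⟨k - 1 + 1, blockProgram c₁ (k - 1) (structP n k), ?_,
    blockProgram_symmetricLinear .., fun A _ 𝔄 => ⟨fun h hcsp => ?_, fun h => ?_⟩⟩
  · rw [Nat.sub_add_cancel hk]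
    have : (1 : ℤ) ≤ k := by exact_mod_cast hk
    nlinarith
  · obtain ⟨f, hf⟩ := (inCsp_iff _ _).1 hcsp
    exact not_derivesGoal_of_isRelHom c₁ (k - 1) hf h
  · by_contra hcon
    let ι : TauEmbedding 𝔄 𝔄 (structP n k) := ⟨id, fun _ _ h => h, fun _ _ h => h⟩
    refine h (inCsp_of_not_derivesGoal (c₁ := c₁) rfl (by omega) ι
      (fun d f hf hfk hmin => ?_) hcon)
    obtain rfl : f = k := by omega
    exact ι.refuted_or_exists_isSolution_last hmin
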